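/- Let $0<\varepsilon<2$, and let $N=N(d)$ be a sequence of non-negative integers with $N(d)=o(d^2/\log d)$ as $d\to\infty$. For $d\ge 2$, indices $i\neq j$ and an angle $\alpha\in\mathbb R$, the Givens rotation $G(i,j,\alpha)$ is the $d\times d$ matrix that has entries $\cos\alpha$ at $(i,i)$ and $(j,j)$, $\sin\alpha$ at $(i,j)$, $-\sin\alpha$ at $(j,i)$, and agrees with the identity matrix elsewhere. Let $\|\cdot\|_2$ be the operator $2$-norm, and let $\mu$ be the Haar measure on the unitary group $U(d)$, normalized by $\mu(U(d))=1$. Then, as $d\to\infty$, $$\mu\Big(\Big\{U\in U(d)\ \Big|\ \inf_{G_1,\dots,G_{N}}\Big\|U-\prod_{n\le N}G_n\Big\|_2\le\varepsilon\Big\}\Big)\longrightarrow 0,$$ where $N=N(d)$ and the infimum is over all sequences of $N$ Givens rotations $G(i,j,\alpha)$. The same holds if the factors $G_n$ range over all two-level unitary matrices (the complex Givens factors, that is, the unitary $d\times d$ matrices that agree with the identity outside the rows and columns $i,j$ for some $i\ne j$). The same also holds, with factors $G(i,j,\alpha)$, for the orthogonal group $O(d)$ and its normalized Haar measure in place of $U(d)$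 and $\mu$. -/

import Mathlib

open Filter Topology MeasureTheory Asymptotics

namespace GivensApprox

/-- The matrix `G(i, j, α)`: cosines at `(i,i)` and `(j,j)`, `sin α` at `(i,j)`, `-sin α` at `(j,i)`,
and the identity matrix elsewhere. -/
noncomputable def givensMatrix (𝕜 : Type) [RCLike 𝕜] {d : ℕ} (i j : Fin d) (α : ℝ) :
    Matrix (Fin d) (Fin d) 𝕜 :=
  Matrix.of fun k l =>
    if (k = i ∧ l = i) ∨ (k = j ∧ l = j) then ((Real.cos α : ℝ) : 𝕜)
    else if k = i ∧ l = j then ((Real.sin α : ℝ) : 𝕜)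
    else if k = j ∧ l = i then -((Real.sin α : ℝ) : 𝕜)
    else if k = l then 1 else 0

/-- The set of all Givens rotations in coordinate planes, with an arbitrary angle. -/
def givensRotations (𝕜 : Type) [RCLike 𝕜] (d : ℕ) : Set (Matrix (Fin d) (Fin d) 𝕜) :=
  {G | ∃ i j : Fin d, i ≠ j ∧ ∃ α : ℝ, G = givensMatrix 𝕜 i j α}

/-- The two-level unitary matrices (complex Givens factors): unitary matrices that agree with the
identity matrix outside the rows and columns `i, j` of some coordinate plane. -/
def twoLevelUnitaries (d : ℕ) : Set (Matrix (Fin d) (Fin d) ℂ) :=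
  {G | G ∈ Matrix.unitaryGroup (Fin d) ℂ ∧ ∃ i j : Fin d, i ≠ j ∧
    ∀ k l : Fin d, ¬ ((k = i ∨ k = j) ∧ (l = i ∨ l = j)) →
      G k l = (1 : Matrix (Fin d) (Fin d) ℂ) k l}

/-- The operator `2`-norm: the norm of the operator induced on Euclidean space. -/
noncomputable def opNorm {𝕜 : Type} [RCLike 𝕜] {d : ℕ} (A : Matrix (Fin d) (Fin d) 𝕜) : ℝ :=
  ‖Matrix.toEuclideanCLM (n := Fin d) (𝕜 := 𝕜) A‖

/-- The unitary matrices `U` with `inf_{G_1, …, G_N} ‖U - G_1 ⋯ G_N‖₂ ≤ ε`, where the factors range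
over the set `S`. For `𝕜 = ℝ`, `Matrix.unitaryGroup (Fin d) ℝ` is the orthogonal group. -/
def approxSet {𝕜 : Type} [RCLike 𝕜] {d : ℕ} (S : Set (Matrix (Fin d) (Fin d) 𝕜)) (N : ℕ) (ε : ℝ) :
    Set (Matrix.unitaryGroup (Fin d) 𝕜) :=
  {U | ⨅ G : Fin N → S,
    opNorm ((U : Matrix (Fin d) (Fin d) 𝕜) -
      (List.ofFn fun n => (G n : Matrix (Fin d) (Fin d) 𝕜)).prod) ≤ ε}

/-- The Borel σ-algebra of the topology inherited from matrices. -/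
instance unitaryMeasurableSpace (𝕜 : Type) [RCLike 𝕜] (d : ℕ) :
    MeasurableSpace (Matrix.unitaryGroup (Fin d) 𝕜) := borel _

instance unitaryBorelSpace (𝕜 : Type) [RCLike 𝕜] (d : ℕ) :
    BorelSpace (Matrix.unitaryGroup (Fin d) 𝕜) := ⟨rfl⟩

open scoped Matrix.Norms.L2Operator in
instance unitaryCompactSpace (𝕜 : Type) [RCLike 𝕜] (d : ℕ) :
    CompactSpace (Matrix.unitaryGroup (Fin d) 𝕜) := by
  have : ProperSpace (Matrix (Fin d) (Fin d) 𝕜) := FiniteDimensional.proper_rclike 𝕜 _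
  refine isCompact_iff_compactSpace.mp (Metric.isCompact_of_isClosed_isBounded ?_ ?_)
  · have : (Matrix.unitaryGroup (Fin d) 𝕜 : Set (Matrix (Fin d) (Fin d) 𝕜)) =
        {A | star A * A = 1} := by
      ext A
      exact Matrix.mem_unitaryGroup_iff'
    rw [this]
    exact isClosed_eq (by fun_prop) continuous_const
  · refine (Metric.isBounded_closedBall (x := (0 : Matrix (Fin d) (Fin d) 𝕜)) (r := 1)).subset ?_
    intro A hA
    rw [mem_closedBall_zero_iff]
    rcases subsingleton_or_nontrivial (Matrix (Fin d) (Fin d) 𝕜) with h | h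
    · simp [Subsingleton.elim A 0]
    · exact (CStarRing.norm_of_mem_unitary hA).le

/-- The Haar measure of the unitary group, normalized to total mass `1`. -/
noncomputable def haar (𝕜 : Type) [RCLike 𝕜] (d : ℕ) :
    Measure (Matrix.unitaryGroup (Fin d) 𝕜) :=
  Measure.haarMeasure ⊤

end GivensApprox

open GivensApprox

namespace GivensApprox

/-! The argument compares a covering number with the measure of a ball. A two-level matrix is
determined by a coordinate plane and four entries, so rounding entries to a polynomially fine grid
puts every product of `N` factors close to one of at most `d ^ (26 N) = exp (o(d ^ 2))` unitaries
(`exists_net`, `opNorm_prod_sub_prod_le`). The set in question is thus covered by that many balls of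
some radius below `2`, and it suffices that each has Haar measure at most `exp (-c d ^ 2)`
(`expSmall_ball`).

For the ball: if `‖U - 1‖ ≤ ε < 2`, the spectrum of `U` avoids a neighbourhood of `-1`, so the
eigenvalues are not equidistributed and some `tr (U ^ a)`, with `a` bounded in terms of `ε`, has
modulus at least a constant times `d`.

For Haar-random `U` such a large trace has probability `exp (-c d ^ 2)` (`expSmall_largePowerSum`).
Integration by parts along plane rotations gives a loop equation bounding the logarithmic derivative
of the moment generating function of `Re (ζ tr (U ^ k))` through products of lower power sums.
Induction on `k`, Gronwall and a Chernoff bound at parameter of order `d` finish. Only real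
rotations are used, so `O(d)` and `U(d)` are treated at once. -/

instance isHaarMeasure_haar (𝕜 : Type) [RCLike 𝕜] (d : ℕ) : (haar 𝕜 d).IsHaarMeasure := by
  unfold haar; infer_instance

instance isProbabilityMeasure_haar (𝕜 : Type) [RCLike 𝕜] (d : ℕ) :
    IsProbabilityMeasure (haar 𝕜 d) :=
  ⟨by simpa [haar] using Measure.haarMeasure_self (K₀ := (⊤ : TopologicalSpace.PositiveCompacts
    (Matrix.unitaryGroup (Fin d) 𝕜)))⟩

/-! ### Integration by parts for invariant measures -/

theorem integrable_of_continuous {X : Type*} [TopologicalSpace X] [CompactSpace X]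
    [MeasurableSpace X] [OpensMeasurableSpace X] (μ : Measure X) [IsFiniteMeasure μ]
    {F : X → ℝ} (hF : Continuous F) : Integrable F μ :=
  hF.integrable_of_hasCompactSupport (HasCompactSupport.of_compactSpace F)

/-- Integration by parts along a one-parameter subgroup. -/
theorem integral_eq_zero_of_hasDerivAt_translate {G : Type*} [Group G] [TopologicalSpace G]
    [IsTopologicalGroup G] [CompactSpace G] [MeasurableSpace G] [BorelSpace G]
    (μ : Measure G) [IsFiniteMeasure μ] [μ.IsMulLeftInvariant]
    (g : ℝ → G) (hg : ∀ s t, g (s + t) = g s * g t)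
    (F F' : G → ℝ) (hF : Continuous F) (hF' : Continuous F')
    (h : ∀ U, HasDerivAt (fun t => F (g t * U)) (F' U) 0) :
    ∫ U, F' U ∂μ = 0 := by
  have hg0 : g 0 = 1 := by
    have := hg 0 0
    simpa using this
  obtain ⟨C, hC⟩ : ∃ C, ∀ U, ‖F' U‖ ≤ C := by
    obtain ⟨C, hC⟩ := isCompact_univ.exists_bound_of_continuousOn (f := F') hF'.continuousOn
    exact ⟨C, fun U => hC U trivial⟩
  -- The homomorphism property carries the derivative at `0`, taken at the point `g t * U`, to time
  -- `t`.
  have hderiv : ∀ U t, HasDerivAt (fun t => F (g t * U)) (F' (g t * U)) t := by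
    intro U t
    have h1 := h (g t * U)
    have h3 : HasDerivAt (fun s => F (g s * (g t * U))) (F' (g t * U)) (t - t) := by
      simpa using h1
    have h4 := h3.comp_sub_const t t
    have : (fun s => F (g (s - t) * (g t * U))) = fun s => F (g s * U) := by
      funext s
      rw [← mul_assoc, ← hg, sub_add_cancel]
    rwa [this] at h4
  have key := (hasDerivAt_integral_of_dominated_loc_of_deriv_le (μ := μ) (x₀ := (0 : ℝ))
    (s := Set.univ) (F := fun t U => F (g t * U)) (F' := fun t U => F' (g t * U))
    (bound := fun _ => C) univ_mem
    (Eventually.of_forall fun t => (integrable_of_continuous μ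
      (hF.comp (continuous_const_mul (g t)))).aestronglyMeasurable)
    (integrable_of_continuous μ (hF.comp (continuous_const_mul (g 0))))
    (integrable_of_continuous μ (hF'.comp (continuous_const_mul (g 0)))).aestronglyMeasurable
    (ae_of_all _ fun U t _ => hC _) (integrable_const C)
    (ae_of_all _ fun U t _ => hderiv U t)).2
  -- By left invariance the integral does not depend on `t`, so its derivative vanishes.
  have hconst : (fun t => ∫ U, F (g t * U) ∂μ) = fun _ => ∫ U, F U ∂μ := by
    ext t
    exact integral_mul_left_eq_self F (g t)
  rw [hconst] at key
  have := key.unique (hasDerivAt_const (0 : ℝ) _)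
  simpa [hg0] using this

/-! ### One-parameter rotation groups and derivatives of traces -/

section Rotation

variable {𝕜 : Type} [RCLike 𝕜] {d : ℕ}

/-- The infinitesimal rotation in the coordinate plane `i, j`. -/
def rotGen (𝕜 : Type) [RCLike 𝕜] {d : ℕ} (i j : Fin d) : Matrix (Fin d) (Fin d) 𝕜 :=
  Matrix.single i j 1 - Matrix.single j i 1

open scoped Matrix.Norms.Operator

theorem exp_smul_rotGen_mem (i j : Fin d) (t : ℝ) :
    NormedSpace.exp (t • rotGen 𝕜 i j) ∈ Matrix.unitaryGroup (Fin d) 𝕜 := by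
  have hstar : (t • rotGen 𝕜 i j).conjTranspose = -(t • rotGen 𝕜 i j) := by
    rw [rotGen, Matrix.conjTranspose_smul, Matrix.conjTranspose_sub, ← smul_neg]
    simp
  rw [Matrix.mem_unitaryGroup_iff', Matrix.star_eq_conjTranspose, ← Matrix.exp_conjTranspose, hstar,
    ← Matrix.exp_add_of_commute _ _ ((Commute.refl (t • rotGen 𝕜 i j)).neg_left), neg_add_cancel]
  exact NormedSpace.exp_zero

theorem exists_oneParameter_rotGen (i j : Fin d) :
    ∃ g : ℝ → Matrix.unitaryGroup (Fin d) 𝕜, (∀ s t, g (s + t) = g s * g t) ∧ g 0 = 1 ∧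
      HasDerivAt (fun t => (g t : Matrix (Fin d) (Fin d) 𝕜)) (rotGen 𝕜 i j) 0 := by
  refine ⟨fun t => ⟨_, exp_smul_rotGen_mem i j t⟩, fun s t => ?_, ?_, ?_⟩
  · apply Subtype.ext
    change NormedSpace.exp ((s + t) • rotGen 𝕜 i j) =
      NormedSpace.exp (s • rotGen 𝕜 i j) * NormedSpace.exp (t • rotGen 𝕜 i j)
    rw [add_smul, Matrix.exp_add_of_commute]
    exact ((Commute.refl (rotGen 𝕜 i j)).smul_left s).smul_right t
  · apply Subtype.ext
    simp
  · have h := hasDerivAt_exp_smul_const (rotGen 𝕜 i j) (0 : ℝ)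
    simp only [zero_smul, NormedSpace.exp_zero, one_mul] at h
    exact h

theorem hasDerivAt_mul_pow {g : ℝ → Matrix (Fin d) (Fin d) 𝕜} {X : Matrix (Fin d) (Fin d) 𝕜}
    (hg0 : g 0 = 1) (hg : HasDerivAt g X 0) (U : Matrix (Fin d) (Fin d) 𝕜) (k : ℕ) :
    HasDerivAt (fun t => (g t * U) ^ k) (∑ a ∈ Finset.range k, U ^ a * X * U ^ (k - a)) 0 := by
  have h := (HasDerivAt.mul_const (c := g) (c' := X) hg U).fun_pow' k
  suffices hs : ∑ a ∈ Finset.range k, U ^ a * X * U ^ (k - a) =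
      ∑ i ∈ Finset.range k, (g 0 * U) ^ (k.pred - i) * (X * U) * (g 0 * U) ^ i by
    rw [hs]
    exact h
  rw [← Finset.sum_range_reflect]
  refine Finset.sum_congr rfl fun a ha => ?_
  have ha := Finset.mem_range.1 ha
  have : k - (k - 1 - a) = 1 + a := by omega
  rw [hg0, this, pow_add]
  simp [mul_assoc, Nat.sub_sub]

theorem hasDerivAt_re_trace {V : ℝ → Matrix (Fin d) (Fin d) 𝕜} {V' : Matrix (Fin d) (Fin d) 𝕜}
    {t : ℝ} (hV : HasDerivAt V V' t) (ζ : 𝕜) (X : Matrix (Fin d) (Fin d) 𝕜) :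
    HasDerivAt (fun t => RCLike.re (ζ * (X * V t).trace)) (RCLike.re (ζ * (X * V').trace)) t := by
  let L : Matrix (Fin d) (Fin d) 𝕜 →ₗ[ℝ] ℝ :=
    { toFun := fun A => RCLike.re (ζ * (X * A).trace)
      map_add' := fun A B => by simp [mul_add]
      map_smul' := fun r A => by
        simp only [mul_smul_comm, Matrix.trace_smul, RCLike.smul_re, RingHom.id_apply, smul_eq_mul] }
  have hL : Continuous L := by
    change Continuous fun A : Matrix (Fin d) (Fin d) 𝕜 => RCLike.re (ζ * (X * A).trace)
    have := RCLike.continuous_re (K := 𝕜)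
    fun_prop
  exact (ContinuousLinearMap.mk L hL).hasFDerivAt.comp_hasDerivAt t hV

end Rotation

/-! ### Trace identities and bounds -/

section Trace

variable {𝕜 : Type} [RCLike 𝕜] {d : ℕ}

theorem trace_rotGen_mul (i j : Fin d) (M : Matrix (Fin d) (Fin d) 𝕜) :
    (rotGen 𝕜 i j * M).trace = M j i - M i j := by
  simp [rotGen, sub_mul, Matrix.trace_single_mul]

theorem trace_single_mul_mul_single_mul (i j k l : Fin d) (A B : Matrix (Fin d) (Fin d) 𝕜) :
    (Matrix.single i j 1 * A * Matrix.single k l 1 * B).trace = A j k * B l i := by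
  rw [mul_assoc, mul_assoc, Matrix.trace_single_mul, Matrix.mul_apply, Finset.sum_eq_single k]
  · simp
  · intro b _ hb
    simp [Matrix.single_mul_apply_of_ne, hb]
  · simp

/-- A Casimir-type identity for `so(d)`: each plane is counted twice and the diagonal pairs
contribute zero. It turns the second-order terms of the loop equation into products of traces. -/
theorem sum_trace_rotGen_mul (A B : Matrix (Fin d) (Fin d) 𝕜) :
    ∑ i, ∑ j, (rotGen 𝕜 i j * A * rotGen 𝕜 i j * B).trace =
      2 * ((A.transpose * B).trace - A.trace * B.trace) := by
  have h1 : ∀ i j : Fin d, (rotGen 𝕜 i j * A * rotGen 𝕜 i j * B).trace =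
      A j i * B j i + A i j * B i j - A j j * B i i - A i i * B j j := by
    intro i j
    simp only [rotGen, sub_mul, mul_sub, Matrix.trace_sub, trace_single_mul_mul_single_mul]
    ring
  have h2 : (A.transpose * B).trace = ∑ i, ∑ j, A j i * B j i := by
    simp [Matrix.trace, Matrix.mul_apply]
  have h3 : (A.transpose * B).trace = ∑ i, ∑ j, A i j * B i j := by
    rw [h2, Finset.sum_comm]
  have h4 : A.trace * B.trace = ∑ i, ∑ j, A i i * B j j := by
    simp [Matrix.trace, Finset.sum_mul_sum]
  have h5 : A.trace * B.trace = ∑ i, ∑ j, A j j * B i i := by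
    rw [h4, Finset.sum_comm]
  simp only [h1, Finset.sum_add_distrib, Finset.sum_sub_distrib]
  rw [← h2, ← h3, ← h4, ← h5]
  ring

theorem trace_sum_mul_mul (U X : Matrix (Fin d) (Fin d) 𝕜) (k : ℕ) :
    (∑ a ∈ Finset.range k, U ^ a * X * U ^ (k - a)).trace = k * (X * U ^ k).trace := by
  rw [Matrix.trace_sum, Finset.sum_congr rfl (g := fun _ => (X * U ^ k).trace)]
  · simp
  · intro a ha
    rw [mul_assoc, Matrix.trace_mul_comm, mul_assoc, ← pow_add,
      Nat.sub_add_cancel (Finset.mem_range.1 ha).le]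

theorem sum_sum_norm_sq_of_mem_unitaryGroup {M : Matrix (Fin d) (Fin d) 𝕜}
    (hM : M ∈ Matrix.unitaryGroup (Fin d) 𝕜) : ∑ i, ∑ j, ‖M i j‖ ^ 2 = d := by
  have h := congrArg Matrix.trace (Matrix.mem_unitaryGroup_iff.1 hM)
  simp only [Matrix.trace, Matrix.diag, Matrix.mul_apply, Matrix.star_apply, ← starRingEnd_apply,
    RCLike.mul_conj, Matrix.one_apply_eq, Finset.sum_const, Finset.card_univ, Fintype.card_fin,
    nsmul_eq_mul, mul_one] at h
  exact_mod_cast h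

theorem norm_trace_transpose_mul_le {A B : Matrix (Fin d) (Fin d) 𝕜}
    (hA : A ∈ Matrix.unitaryGroup (Fin d) 𝕜) (hB : B ∈ Matrix.unitaryGroup (Fin d) 𝕜) :
    ‖(A.transpose * B).trace‖ ≤ d := by
  have h2 : (A.transpose * B).trace = ∑ j, ∑ i, A j i * B j i := by
    rw [Finset.sum_comm]
    simp [Matrix.trace, Matrix.mul_apply]
  have h3 : ∀ j i, ‖A j i * B j i‖ ≤ (‖A j i‖ ^ 2 + ‖B j i‖ ^ 2) / 2 := by
    intro j i
    rw [norm_mul]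
    nlinarith [sq_nonneg (‖A j i‖ - ‖B j i‖)]
  calc ‖(A.transpose * B).trace‖ ≤ ∑ j, ∑ i, (‖A j i‖ ^ 2 + ‖B j i‖ ^ 2) / 2 := by
        rw [h2]
        exact norm_sum_le_of_le _ fun j _ => norm_sum_le_of_le _ fun i _ => h3 j i
    _ = d := by
        simp_rw [← Finset.sum_div, Finset.sum_add_distrib]
        rw [sum_sum_norm_sq_of_mem_unitaryGroup hA, sum_sum_norm_sq_of_mem_unitaryGroup hB]
        ring

theorem norm_trace_le_of_mem_unitaryGroup {A : Matrix (Fin d) (Fin d) 𝕜}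
    (hA : A ∈ Matrix.unitaryGroup (Fin d) 𝕜) : ‖A.trace‖ ≤ d := by
  simpa using norm_trace_transpose_mul_le (one_mem _) hA

/-- The sum is controlled by the squared Frobenius norm of `M`, which is `d`. This is of order `d`
although there are `d ^ 2` terms, which permits exponential parameters of order `d`. -/
theorem sum_re_trace_rotGen_mul_sq_le {M : Matrix (Fin d) (Fin d) 𝕜}
    (hM : M ∈ Matrix.unitaryGroup (Fin d) 𝕜) {ζ : 𝕜} (hζ : ‖ζ‖ ≤ 1) :
    ∑ i, ∑ j, RCLike.re (ζ * (rotGen 𝕜 i j * M).trace) ^ 2 ≤ 4 * (d : ℝ) := by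
  have h : ∀ i j, RCLike.re (ζ * (rotGen 𝕜 i j * M).trace) ^ 2 ≤
      2 * ‖M j i‖ ^ 2 + 2 * ‖M i j‖ ^ 2 := by
    intro i j
    rw [trace_rotGen_mul]
    have h1 : |RCLike.re (ζ * (M j i - M i j))| ≤ ‖M j i‖ + ‖M i j‖ := by
      refine (RCLike.abs_re_le_norm _).trans ?_
      rw [norm_mul]
      refine (mul_le_of_le_one_left (norm_nonneg _) hζ).trans (norm_sub_le _ _)
    rw [← sq_abs]
    nlinarith [sq_nonneg (‖M j i‖ - ‖M i j‖), abs_nonneg (RCLike.re (ζ * (M j i - M i j))),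
      norm_nonneg (M j i), norm_nonneg (M i j)]
  calc _ ≤ ∑ i, ∑ j, (2 * ‖M j i‖ ^ 2 + 2 * ‖M i j‖ ^ 2) :=
        Finset.sum_le_sum fun i _ => Finset.sum_le_sum fun j _ => h i j
    _ = 4 * (d : ℝ) := by
        simp_rw [Finset.sum_add_distrib, ← Finset.mul_sum]
        rw [Finset.sum_comm, sum_sum_norm_sq_of_mem_unitaryGroup hM]
        ring

end Trace

/-! ### The loop equation for power sums -/

section Loop

variable {𝕜 : Type} [RCLike 𝕜] {d : ℕ}

/-- The power sum `tr (U ^ k)` of the eigenvalues. -/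
def powerSum (k : ℕ) (U : Matrix.unitaryGroup (Fin d) 𝕜) : 𝕜 :=
  ((U : Matrix (Fin d) (Fin d) 𝕜) ^ k).trace

theorem continuous_powerSum (k : ℕ) :
    Continuous (powerSum k : Matrix.unitaryGroup (Fin d) 𝕜 → 𝕜) := by
  unfold powerSum
  fun_prop

theorem norm_powerSum_le (k : ℕ) (U : Matrix.unitaryGroup (Fin d) 𝕜) : ‖powerSum k U‖ ≤ d :=
  norm_trace_le_of_mem_unitaryGroup (pow_mem U.2 k)

/-- A real linear functional of the power sum. -/
def powerSumRe (k : ℕ) (ζ : 𝕜) (U : Matrix.unitaryGroup (Fin d) 𝕜) : ℝ :=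
  RCLike.re (ζ * powerSum k U)

theorem continuous_powerSumRe (k : ℕ) (ζ : 𝕜) :
    Continuous (powerSumRe k ζ : Matrix.unitaryGroup (Fin d) 𝕜 → ℝ) :=
  RCLike.continuous_re.comp (continuous_const.mul (continuous_powerSum k))

theorem abs_powerSumRe_le (k : ℕ) {ζ : 𝕜} (hζ : ‖ζ‖ ≤ 1) (U : Matrix.unitaryGroup (Fin d) 𝕜) :
    |powerSumRe k ζ U| ≤ d := by
  refine (RCLike.abs_re_le_norm _).trans ?_
  rw [norm_mul]
  exact (mul_le_of_le_one_left (norm_nonneg _) hζ).trans (norm_powerSum_le k U)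

/-- Integration by parts for `Re (ζ tr (X U ^ k)) exp (lam Re (ζ tr (U ^ k)))` with `X` the rotation
generator. The first summand differentiates the prefactor; the square comes from the exponential. -/
theorem integral_rotGen_eq_zero (k : ℕ) (ζ : 𝕜) (lam : ℝ) (i j : Fin d) :
    ∫ U : Matrix.unitaryGroup (Fin d) 𝕜,
      (RCLike.re (ζ * ∑ a ∈ Finset.range k,
          (rotGen 𝕜 i j * (U : Matrix (Fin d) (Fin d) 𝕜) ^ a * rotGen 𝕜 i j * (U : Matrix (Fin d) (Fin d) 𝕜) ^ (k - a)).trace)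
        + lam * k * RCLike.re (ζ * (rotGen 𝕜 i j * (U : Matrix (Fin d) (Fin d) 𝕜) ^ k).trace) ^ 2) *
      Real.exp (lam * powerSumRe k ζ U) ∂(haar 𝕜 d) = 0 := by
  obtain ⟨g, hg, hg0, hd⟩ := exists_oneParameter_rotGen (𝕜 := 𝕜) i j
  have hre := RCLike.continuous_re (K := 𝕜)
  have hexp : Continuous fun U : Matrix.unitaryGroup (Fin d) 𝕜 =>
      Real.exp (lam * powerSumRe k ζ U) := by
    have := continuous_powerSumRe (d := d) k ζ
    fun_prop
  refine integral_eq_zero_of_hasDerivAt_translate (haar 𝕜 d) g hg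
    (fun U => RCLike.re (ζ * (rotGen 𝕜 i j * (U : Matrix (Fin d) (Fin d) 𝕜) ^ k).trace) *
      Real.exp (lam * powerSumRe k ζ U)) _ ?_ ?_ ?_
  · exact Continuous.mul (by fun_prop) hexp
  · exact Continuous.mul (by fun_prop) hexp
  · intro U
    have h1 := hasDerivAt_mul_pow (congrArg Subtype.val hg0) hd (U : Matrix (Fin d) (Fin d) 𝕜) k
    have h2 := hasDerivAt_re_trace h1 ζ (rotGen 𝕜 i j)
    have h3 := hasDerivAt_re_trace h1 ζ 1
    have h4 := h2.mul ((h3.const_mul lam).exp)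
    simp only [one_mul] at h4
    refine HasDerivAt.congr_deriv h4 ?_
    have e1 : (((g 0 : Matrix.unitaryGroup (Fin d) 𝕜) : Matrix (Fin d) (Fin d) 𝕜) * U) = U := by
      rw [hg0]; simp
    have e2 : ζ * ((k : 𝕜) * (rotGen 𝕜 i j * (U : Matrix (Fin d) (Fin d) 𝕜) ^ k).trace) =
        ((k : ℝ) : 𝕜) * (ζ * (rotGen 𝕜 i j * (U : Matrix (Fin d) (Fin d) 𝕜) ^ k).trace) := by
      push_cast; ring
    rw [e1, trace_sum_mul_mul, e2, RCLike.re_ofReal_mul, Finset.mul_sum, Matrix.trace_sum]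
    simp only [← mul_assoc]
    unfold powerSumRe powerSum
    ring

theorem continuous_exp_powerSumRe (k : ℕ) (ζ : 𝕜) (lam : ℝ) :
    Continuous fun U : Matrix.unitaryGroup (Fin d) 𝕜 => Real.exp (lam * powerSumRe k ζ U) := by
  have := continuous_powerSumRe (d := d) k ζ
  fun_prop

/-- Since `tr (U ^ 0) = d`, the term `a = 0` yields the restoring drift `-2 (d - 1) Re (ζ tr (U ^
k))`. The other terms involve only power sums of index below `k`, plus transposed traces of size at
most `d`. -/
theorem loop_integrand_le {k : ℕ} (hk : 1 ≤ k) {ζ : 𝕜} (hζ : ‖ζ‖ ≤ 1) {lam : ℝ} (hlam : 0 ≤ lam)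
    (U : Matrix.unitaryGroup (Fin d) 𝕜) :
    ∑ i : Fin d, ∑ j : Fin d, (RCLike.re (ζ * ∑ a ∈ Finset.range k,
          (rotGen 𝕜 i j * (U : Matrix (Fin d) (Fin d) 𝕜) ^ a * rotGen 𝕜 i j * (U : Matrix (Fin d) (Fin d) 𝕜) ^ (k - a)).trace)
        + lam * k * RCLike.re (ζ * (rotGen 𝕜 i j * (U : Matrix (Fin d) (Fin d) 𝕜) ^ k).trace) ^ 2) ≤
      2 * (k * d + 2 * lam * k * d + ∑ a ∈ Finset.Ico 1 k, ‖powerSum a U‖ * ‖powerSum (k - a) U‖)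
        - 2 * (d - 1) * powerSumRe k ζ U := by
  have h1 : ∑ i : Fin d, ∑ j : Fin d, RCLike.re (ζ * ∑ a ∈ Finset.range k,
      (rotGen 𝕜 i j * (U : Matrix (Fin d) (Fin d) 𝕜) ^ a * rotGen 𝕜 i j * (U : Matrix (Fin d) (Fin d) 𝕜) ^ (k - a)).trace) =
      ∑ a ∈ Finset.range k, RCLike.re (ζ * (2 * ((((U : Matrix (Fin d) (Fin d) 𝕜) ^ a).transpose *
        (U : Matrix (Fin d) (Fin d) 𝕜) ^ (k - a)).trace - powerSum a U * powerSum (k - a) U))) := by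
    simp_rw [powerSum, ← sum_trace_rotGen_mul, Finset.mul_sum, map_sum]
    rw [Finset.sum_comm (s := Finset.range k)]
    exact Finset.sum_congr rfl fun i _ => Finset.sum_comm
  have h2 : ∀ a ∈ Finset.Ico 1 k, RCLike.re (ζ * (2 * ((((U : Matrix (Fin d) (Fin d) 𝕜) ^ a).transpose *
        (U : Matrix (Fin d) (Fin d) 𝕜) ^ (k - a)).trace - powerSum a U * powerSum (k - a) U))) ≤
      2 * (d + ‖powerSum a U‖ * ‖powerSum (k - a) U‖) := by
    intro a _
    refine (RCLike.re_le_norm _).trans ?_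
    rw [norm_mul, norm_mul, RCLike.norm_two]
    refine (mul_le_of_le_one_left (by positivity) hζ).trans ?_
    gcongr
    refine (norm_sub_le _ _).trans ?_
    rw [norm_mul]
    gcongr
    exact norm_trace_transpose_mul_le (pow_mem U.2 a) (pow_mem U.2 (k - a))
  have h3 : RCLike.re (ζ * (2 * ((((U : Matrix (Fin d) (Fin d) 𝕜) ^ 0).transpose *
        (U : Matrix (Fin d) (Fin d) 𝕜) ^ (k - 0)).trace - powerSum 0 U * powerSum (k - 0) U))) =
      - 2 * (d - 1) * powerSumRe k ζ U := by
    have : ζ * (2 * ((((U : Matrix (Fin d) (Fin d) 𝕜) ^ 0).transpose *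
        (U : Matrix (Fin d) (Fin d) 𝕜) ^ (k - 0)).trace - powerSum 0 U * powerSum (k - 0) U)) =
        ((-2 * (d - 1) : ℝ) : 𝕜) * (ζ * powerSum k U) := by
      have h2 : (algebraMap ℝ 𝕜) 2 = 2 := map_ofNat _ 2
      simp only [powerSum, pow_zero, Matrix.transpose_one, one_mul, Matrix.trace_one,
        Fintype.card_fin, Nat.sub_zero]
      push_cast
      ring
    rw [this, RCLike.re_ofReal_mul, powerSumRe]
  simp_rw [Finset.sum_add_distrib, ← Finset.mul_sum]
  rw [h1, Finset.range_eq_Ico, Finset.sum_eq_sum_Ico_succ_bot (by omega), h3]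
  have h4 := Finset.sum_le_sum h2
  have h5 := sum_re_trace_rotGen_mul_sq_le (pow_mem U.2 k) hζ
  have h6 : (0 : ℝ) ≤ lam * k := by positivity
  have h7 := mul_le_mul_of_nonneg_left h5 h6
  rw [← Finset.mul_sum, Finset.sum_add_distrib, Finset.sum_const, Nat.card_Ico, nsmul_eq_mul] at h4
  have h8 : ((k - 1 : ℕ) : ℝ) * d ≤ k * d := by gcongr; omega
  simp only [zero_add] at h4 h7 ⊢
  linarith

/-- The loop equation bounds the derivative of the moment generating function of a power sum. -/
theorem loop_inequality {k : ℕ} (hk : 1 ≤ k) {ζ : 𝕜} (hζ : ‖ζ‖ ≤ 1) {lam : ℝ} (hlam : 0 ≤ lam) :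
    (d - 1) * ∫ U, powerSumRe k ζ U * Real.exp (lam * powerSumRe k ζ U) ∂(haar 𝕜 d) ≤
      ∫ U, (k * d + 2 * lam * k * d +
        ∑ a ∈ Finset.Ico 1 k, ‖powerSum a U‖ * ‖powerSum (k - a) U‖) *
          Real.exp (lam * powerSumRe k ζ U) ∂(haar 𝕜 d) := by
  have hexp := continuous_exp_powerSumRe (d := d) k ζ lam
  have hre := RCLike.continuous_re (K := 𝕜)
  have hf := continuous_powerSumRe (d := d) k ζ
  have hp : ∀ a, Continuous (powerSum a : Matrix.unitaryGroup (Fin d) 𝕜 → 𝕜) :=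
    continuous_powerSum
  have hi : ∀ i j : Fin d, Integrable (fun U : Matrix.unitaryGroup (Fin d) 𝕜 =>
      (RCLike.re (ζ * ∑ a ∈ Finset.range k,
          (rotGen 𝕜 i j * (U : Matrix (Fin d) (Fin d) 𝕜) ^ a * rotGen 𝕜 i j * (U : Matrix (Fin d) (Fin d) 𝕜) ^ (k - a)).trace)
        + lam * k * RCLike.re (ζ * (rotGen 𝕜 i j * (U : Matrix (Fin d) (Fin d) 𝕜) ^ k).trace) ^ 2) *
      Real.exp (lam * powerSumRe k ζ U)) (haar 𝕜 d) := by
    intro i j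
    exact integrable_of_continuous _ (Continuous.mul (by fun_prop) hexp)
  have h1 : ∫ U : Matrix.unitaryGroup (Fin d) 𝕜, ∑ i : Fin d, ∑ j : Fin d,
      (RCLike.re (ζ * ∑ a ∈ Finset.range k,
          (rotGen 𝕜 i j * (U : Matrix (Fin d) (Fin d) 𝕜) ^ a * rotGen 𝕜 i j * (U : Matrix (Fin d) (Fin d) 𝕜) ^ (k - a)).trace)
        + lam * k * RCLike.re (ζ * (rotGen 𝕜 i j * (U : Matrix (Fin d) (Fin d) 𝕜) ^ k).trace) ^ 2) *
      Real.exp (lam * powerSumRe k ζ U) ∂(haar 𝕜 d) = 0 := by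
    rw [integral_finsetSum _ fun i _ => integrable_finsetSum _ fun j _ => hi i j]
    refine Finset.sum_eq_zero fun i _ => ?_
    rw [integral_finsetSum _ fun j _ => hi i j]
    exact Finset.sum_eq_zero fun j _ => integral_rotGen_eq_zero k ζ lam i j
  have i1 : Integrable (fun U => powerSumRe k ζ U * Real.exp (lam * powerSumRe k ζ U))
      (haar 𝕜 d) := integrable_of_continuous _ (hf.mul hexp)
  have i2 : Integrable (fun U => (k * d + 2 * lam * k * d +
      ∑ a ∈ Finset.Ico 1 k, ‖powerSum a U‖ * ‖powerSum (k - a) U‖) *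
        Real.exp (lam * powerSumRe k ζ U)) (haar 𝕜 d) :=
    integrable_of_continuous _ (Continuous.mul (by fun_prop) hexp)
  have h2 := integral_mono (integrable_finsetSum Finset.univ fun i _ =>
    integrable_finsetSum Finset.univ fun j _ => hi i j)
    ((i2.const_mul 2).sub (i1.const_mul (2 * ((d : ℝ) - 1)))) fun U => by
      simp only [Pi.sub_apply, ← Finset.sum_mul]
      have := mul_le_mul_of_nonneg_right (loop_integrand_le hk hζ hlam U)
        (Real.exp_pos (lam * powerSumRe k ζ U)).le
      refine this.trans (le_of_eq ?_)
      ring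
  rw [h1] at h2
  have h3 := integral_sub (i2.const_mul 2) (i1.const_mul (2 * ((d : ℝ) - 1)))
  simp only [Pi.sub_apply] at h2
  rw [h3, integral_const_mul, integral_const_mul] at h2
  linarith

end Loop

/-! ### Decay of order `exp (-c d ^ 2)` -/

section ExpSmall

/-- Sequences with a bound `exp (-c d ^ 2)` for some `c > 0` and all large `d`. -/
def ExpSmall (u : ℕ → ℝ) : Prop := ∃ c > 0, ∀ᶠ d : ℕ in atTop, u d ≤ Real.exp (-c * (d : ℝ) ^ 2)

theorem eventually_one_add_mul_sq_le_exp (A : ℝ) {a : ℝ} (ha : 0 < a) :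
    ∀ᶠ d : ℕ in atTop, 1 + A * (d : ℝ) ^ 2 ≤ Real.exp (a * (d : ℝ) ^ 2) := by
  filter_upwards [tendsto_natCast_atTop_atTop.eventually_ge_atTop (max 1 (2 * A / a ^ 2))]
    with d hd
  have h1 : (1 : ℝ) ≤ d := (le_max_left _ _).trans hd
  have h2 : 2 * A / a ^ 2 ≤ d := (le_max_right _ _).trans hd
  have h3 : (d : ℝ) ≤ (d : ℝ) ^ 2 := by nlinarith
  have h4 : 2 * A ≤ (d : ℝ) ^ 2 * a ^ 2 := by
    rw [div_le_iff₀ (by positivity)] at h2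
    nlinarith [mul_le_mul_of_nonneg_right h3 (sq_nonneg a)]
  have h5 := Real.quadratic_le_exp_of_nonneg (x := a * (d : ℝ) ^ 2) (by positivity)
  have h6 : 0 ≤ a * (d : ℝ) ^ 2 := by positivity
  nlinarith [mul_le_mul_of_nonneg_right h4 (sq_nonneg (d : ℝ))]

theorem ExpSmall.mono {u v : ℕ → ℝ} (hu : ExpSmall u) (h : ∀ᶠ d in atTop, v d ≤ u d) :
    ExpSmall v := by
  obtain ⟨c, hc, hu⟩ := hu
  exact ⟨c, hc, by filter_upwards [hu, h] with d h1 h2 using h2.trans h1⟩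

theorem ExpSmall.add {u v : ℕ → ℝ} (hu : ExpSmall u) (hv : ExpSmall v) :
    ExpSmall fun d => u d + v d := by
  obtain ⟨c, hc, hu⟩ := hu
  obtain ⟨c', hc', hv⟩ := hv
  have hm : 0 < min c c' := lt_min hc hc'
  -- Half of the rate is given up to absorb the factor `2 ≤ 1 + d ^ 2`.
  refine ⟨min c c' / 2, by positivity, ?_⟩
  filter_upwards [hu, hv, eventually_one_add_mul_sq_le_exp 1 (half_pos hm),
    eventually_ge_atTop 1] with d h1 h2 h3 h4
  have h5 : (1 : ℝ) ≤ (d : ℝ) ^ 2 := one_le_pow₀ (by exact_mod_cast h4)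
  have h6 : ∀ b, min c c' ≤ b → Real.exp (-b * (d : ℝ) ^ 2) ≤
      Real.exp (-(min c c' / 2) * (d : ℝ) ^ 2) * Real.exp (-(min c c' / 2) * (d : ℝ) ^ 2) := by
    intro b hb
    rw [← Real.exp_add]
    gcongr
    nlinarith
  have h7 := h6 c (min_le_left _ _)
  have h8 := h6 c' (min_le_right _ _)
  set E := Real.exp (-(min c c' / 2) * (d : ℝ) ^ 2) with hE
  have h9 : E * Real.exp (min c c' / 2 * (d : ℝ) ^ 2) = 1 := by
    rw [hE, ← Real.exp_add]
    simp
  have hE0 : 0 < E := Real.exp_pos _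
  nlinarith [mul_le_mul_of_nonneg_left h3 hE0.le]

end ExpSmall

/-! ### A Gronwall inequality -/

section Gronwall

/-- A one-sided Gronwall inequality. -/
theorem le_exp_mul_of_deriv_le {φ φ' : ℝ → ℝ} {K β L : ℝ} (hL : 0 ≤ L) (hK : 0 ≤ K) (hβ : 0 ≤ β)
    (hd : ∀ t, HasDerivAt φ (φ' t) t) (h : ∀ t, 0 ≤ t → t ≤ L → φ' t ≤ K * φ t + β) :
    φ L ≤ Real.exp (K * L) * (φ 0 + β * L) := by
  -- Integrating factor `exp (-K t)`; as it is at most `1` for `t ≥ 0`, subtracting `β t` makes the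
  -- function antitone.
  have hg : ∀ t, HasDerivAt (fun t => φ t * Real.exp (-K * t) - β * t)
      (φ' t * Real.exp (-K * t) + φ t * (Real.exp (-K * t) * -K) - β) t := by
    intro t
    have h1 : HasDerivAt (fun t : ℝ => -K * t) (-K) t := by
      simpa using (hasDerivAt_id t).const_mul (-K)
    have h2 : HasDerivAt (fun t : ℝ => β * t) β t := by
      simpa using (hasDerivAt_id t).const_mul β
    exact ((hd t).mul h1.exp).sub h2
  have hanti : AntitoneOn (fun t => φ t * Real.exp (-K * t) - β * t) (Set.Icc 0 L) := by
    refine antitoneOn_of_deriv_nonpos (convex_Icc 0 L)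
      (fun t _ => (hg t).continuousAt.continuousWithinAt)
      (fun t _ => (hg t).differentiableAt.differentiableWithinAt) fun t ht => ?_
    rw [interior_Icc] at ht
    rw [(hg t).deriv]
    have h1 := h t ht.1.le ht.2.le
    have h2 : Real.exp (-K * t) ≤ 1 := Real.exp_le_one_iff.2 (by nlinarith [ht.1])
    have h3 := Real.exp_pos (-K * t)
    nlinarith [mul_le_mul_of_nonneg_right h1 h3.le, mul_le_mul_of_nonneg_left h2 hβ]
  have h1 := hanti (Set.left_mem_Icc.2 hL) (Set.right_mem_Icc.2 hL) hL
  simp only [mul_zero, Real.exp_zero, mul_one, sub_zero] at h1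
  have h2 : Real.exp (K * L) * Real.exp (-K * L) = 1 := by
    rw [← Real.exp_add]; simp
  have h3 := mul_le_mul_of_nonneg_left h1 (Real.exp_pos (K * L)).le
  linear_combination h3 - φ L * h2

end Gronwall

/-! ### Large deviations of power sums -/

section Tail

variable {𝕜 : Type} [RCLike 𝕜] {d : ℕ}

/-- The event that some power sum of index in `[1, k)` has modulus at least `δ d`. -/
def largePowerSum (𝕜 : Type) [RCLike 𝕜] (k d : ℕ) (δ : ℝ) : Set (Matrix.unitaryGroup (Fin d) 𝕜) :=
  {U | ∃ a ∈ Finset.Ico 1 k, δ * d ≤ ‖powerSum a U‖}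

theorem isClosed_largePowerSum (k d : ℕ) (δ : ℝ) : IsClosed (largePowerSum 𝕜 k d δ) := by
  have : largePowerSum 𝕜 k d δ =
      ⋃ a ∈ Finset.Ico 1 k, {U | δ * d ≤ ‖powerSum a U‖} := by
    ext U; simp [largePowerSum]
  rw [this]
  exact isClosed_biUnion_finset fun a _ =>
    isClosed_le continuous_const (continuous_powerSum a).norm

theorem hasDerivAt_mgf_powerSumRe (k : ℕ) (ζ : 𝕜) (t : ℝ) :
    HasDerivAt (ProbabilityTheory.mgf (powerSumRe k ζ) (haar 𝕜 d))
      (∫ U, powerSumRe k ζ U * Real.exp (t * powerSumRe k ζ U) ∂(haar 𝕜 d)) t := by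
  refine ProbabilityTheory.hasDerivAt_mgf ?_
  have : ProbabilityTheory.integrableExpSet (powerSumRe k ζ) (haar 𝕜 d) = Set.univ :=
    Set.eq_univ_of_forall fun t => integrable_of_continuous _ (continuous_exp_powerSumRe k ζ t)
  simp [this]

theorem sum_norm_powerSum_mul_le {k : ℕ} {δ : ℝ} (hδ : 0 ≤ δ)
    (U : Matrix.unitaryGroup (Fin d) 𝕜) :
    ∑ a ∈ Finset.Ico 1 k, ‖powerSum a U‖ * ‖powerSum (k - a) U‖ ≤
      k * δ ^ 2 * d ^ 2 + (largePowerSum 𝕜 k d δ).indicator (fun _ => (k : ℝ) * d ^ 2) U := by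
  have hc : ((Finset.Ico 1 k).card : ℝ) ≤ k := by
    rw [Nat.card_Ico]; exact_mod_cast Nat.sub_le k 1
  by_cases hU : U ∈ largePowerSum 𝕜 k d δ
  · rw [Set.indicator_of_mem hU]
    have h1 : ∑ a ∈ Finset.Ico 1 k, ‖powerSum a U‖ * ‖powerSum (k - a) U‖ ≤
        (Finset.Ico 1 k).card • ((d : ℝ) ^ 2) := by
      refine Finset.sum_le_card_nsmul _ _ _ fun a _ => ?_
      rw [sq]
      exact mul_le_mul (norm_powerSum_le _ _) (norm_powerSum_le _ _) (norm_nonneg _)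
        (Nat.cast_nonneg _)
    rw [nsmul_eq_mul] at h1
    have h2 := mul_le_mul_of_nonneg_right hc (sq_nonneg (d : ℝ))
    have h3 : 0 ≤ k * δ ^ 2 * (d : ℝ) ^ 2 := by positivity
    linarith
  · rw [Set.indicator_of_notMem hU, add_zero]
    have hU' : ∀ a ∈ Finset.Ico 1 k, ‖powerSum a U‖ ≤ δ * d := by
      intro a ha
      by_contra! h
      exact hU ⟨a, ha, h.le⟩
    have h1 : ∑ a ∈ Finset.Ico 1 k, ‖powerSum a U‖ * ‖powerSum (k - a) U‖ ≤
        (Finset.Ico 1 k).card • ((δ * d) * (δ * d)) := by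
      refine Finset.sum_le_card_nsmul _ _ _ fun a ha => ?_
      refine mul_le_mul (hU' a ha) (hU' _ ?_) (norm_nonneg _) (by positivity)
      rw [Finset.mem_Ico] at ha ⊢
      omega
    rw [nsmul_eq_mul] at h1
    have h2 := mul_le_mul_of_nonneg_right hc (by positivity : 0 ≤ (δ * d) * (δ * d))
    linarith

/-- Off the bad event the lower power sums are below `δ d`; on it the trivial bounds by `d` cost
`exp (L d)` times its probability. -/
theorem integral_powerSumRe_mul_exp_le {k : ℕ} (hk : 1 ≤ k) (hd : 2 ≤ d) {ζ : 𝕜} (hζ : ‖ζ‖ ≤ 1)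
    {t L δ : ℝ} (ht : 0 ≤ t) (htL : t ≤ L) (hδ : 0 ≤ δ) :
    ∫ U, powerSumRe k ζ U * Real.exp (t * powerSumRe k ζ U) ∂(haar 𝕜 d) ≤
      2 * k * (1 + 2 * L + δ ^ 2 * d) * ProbabilityTheory.mgf (powerSumRe k ζ) (haar 𝕜 d) t +
        2 * k * d * (Real.exp (L * d) * (haar 𝕜 d).real (largePowerSum 𝕜 k d δ)) := by
  have hmeas := (isClosed_largePowerSum (𝕜 := 𝕜) k d δ).measurableSet
  have hd0 : (2 : ℝ) ≤ d := by exact_mod_cast hd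
  have hp : ∀ a, Continuous (powerSum a : Matrix.unitaryGroup (Fin d) 𝕜 → 𝕜) :=
    continuous_powerSum
  have hexp := continuous_exp_powerSumRe (d := d) k ζ t
  have i1 : Integrable (fun U => (k * d + 2 * t * k * d +
      ∑ a ∈ Finset.Ico 1 k, ‖powerSum a U‖ * ‖powerSum (k - a) U‖) *
        Real.exp (t * powerSumRe k ζ U)) (haar 𝕜 d) :=
    integrable_of_continuous _ (Continuous.mul (by fun_prop) hexp)
  have i2 : Integrable (fun U => (k * d + 2 * L * k * d + k * δ ^ 2 * d ^ 2) *
      Real.exp (t * powerSumRe k ζ U)) (haar 𝕜 d) :=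
    (integrable_of_continuous _ hexp).const_mul _
  have i3 : Integrable ((largePowerSum 𝕜 k d δ).indicator
      fun _ => (k : ℝ) * d ^ 2 * Real.exp (L * d)) (haar 𝕜 d) :=
    (integrable_const _).indicator hmeas
  have h1 := (loop_inequality (d := d) hk hζ ht).trans (integral_mono i1 (i2.add i3) fun U => ?_)
  · have h2 := integral_add i2 i3
    simp only [Pi.add_apply] at h1
    rw [h2, integral_const_mul, integral_indicator_const _ hmeas, smul_eq_mul] at h1
    change _ ≤ _ * ProbabilityTheory.mgf (powerSumRe k ζ) (haar 𝕜 d) t + _ at h1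
    set I := ∫ U, powerSumRe k ζ U * Real.exp (t * powerSumRe k ζ U) ∂(haar 𝕜 d)
    set m := ProbabilityTheory.mgf (powerSumRe k ζ) (haar 𝕜 d) t with hm
    set b := (haar 𝕜 d).real (largePowerSum 𝕜 k d δ) with hb
    set R := 2 * k * (1 + 2 * L + δ ^ 2 * d) * m + 2 * k * d * (Real.exp (L * d) * b) with hR
    have hm0 : 0 ≤ m := ProbabilityTheory.mgf_nonneg
    have hb0 : 0 ≤ b := measureReal_nonneg
    have hL : 0 ≤ L := ht.trans htL
    have hR0 : 0 ≤ R := by positivity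
    -- Since `d ≥ 2` gives `d / 2 ≤ d - 1`, dividing by `d - 1` costs at most a factor `2`.
    have h3 : (d - 1) * I ≤ d / 2 * R := by
      refine h1.trans (le_of_eq ?_)
      rw [hR]
      ring
    by_contra! hI
    nlinarith [mul_lt_mul_of_pos_left hI (by linarith : (0 : ℝ) < d - 1)]
  · simp only [Pi.add_apply]
    have h2 := sum_norm_powerSum_mul_le (k := k) hδ U
    have h3 : t * powerSumRe k ζ U ≤ L * d := by
      have := (abs_le.1 (abs_powerSumRe_le k hζ U)).2
      nlinarith
    have h4 : (largePowerSum 𝕜 k d δ).indicator (fun _ => (k : ℝ) * d ^ 2) U *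
        Real.exp (t * powerSumRe k ζ U) ≤
        (largePowerSum 𝕜 k d δ).indicator (fun _ => (k : ℝ) * d ^ 2 * Real.exp (L * d)) U := by
      by_cases hU : U ∈ largePowerSum 𝕜 k d δ
      · simp only [Set.indicator_of_mem hU]
        gcongr
      · simp [Set.indicator_of_notMem hU]
    have h5 : 2 * t * k * d ≤ 2 * L * k * d := by gcongr
    have h6 := mul_le_mul_of_nonneg_right (add_le_add (add_le_add_right h5 (k * d : ℝ)) h2)
      (Real.exp_pos (t * powerSumRe k ζ U)).le
    refine h6.trans ?_
    linarith

/-- Chernoff bound at parameter `L`, with the moment generating function estimated by Gronwall from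
its value `1` at `0`. -/
theorem measureReal_powerSumRe_ge_le {k : ℕ} (hk : 1 ≤ k) (hd : 2 ≤ d) {ζ : 𝕜} (hζ : ‖ζ‖ ≤ 1)
    {L δ : ℝ} (hL : 0 ≤ L) (hδ : 0 ≤ δ) (x : ℝ) :
    (haar 𝕜 d).real {U | x ≤ powerSumRe k ζ U} ≤
      Real.exp (-L * x) * (Real.exp (2 * k * (1 + 2 * L + δ ^ 2 * d) * L) *
        (1 + 2 * k * d * (Real.exp (L * d) * (haar 𝕜 d).real (largePowerSum 𝕜 k d δ)) * L)) := by
  refine (ProbabilityTheory.measure_ge_le_exp_mul_mgf x hL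
    (integrable_of_continuous _ (continuous_exp_powerSumRe k ζ L))).trans ?_
  gcongr
  have h := le_exp_mul_of_deriv_le (L := L) hL
    (by positivity : 0 ≤ 2 * k * (1 + 2 * L + δ ^ 2 * d))
    (by positivity :
      0 ≤ 2 * k * d * (Real.exp (L * d) * (haar 𝕜 d).real (largePowerSum 𝕜 k d δ)))
    (hasDerivAt_mgf_powerSumRe (d := d) k ζ) fun t ht htL =>
      integral_powerSumRe_mul_exp_le hk hd hζ ht htL hδ
  simpa using h

/-- Taking `L = s d`, the Chernoff gain is `c s d ^ 2`. The choices of `δ` and `s` keep the Gronwall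
exponent below `3 c s d ^ 2 / 8`, and `c s d ^ 2 / 8` more pays for the polynomial factor. -/
theorem expSmall_powerSumRe_ge {k : ℕ} (hk : 1 ≤ k)
    (hbad : ∀ δ > 0, ExpSmall fun d => (haar 𝕜 d).real (largePowerSum 𝕜 k d δ))
    {ζ : 𝕜} (hζ : ‖ζ‖ ≤ 1) {c : ℝ} (hc : 0 < c) :
    ExpSmall fun d => (haar 𝕜 d).real {U | c * d ≤ powerSumRe k ζ U} := by
  have hk0 : (0 : ℝ) < k := by exact_mod_cast hk
  set δ := Real.sqrt (c / (16 * k)) with hδ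
  have hδ0 : 0 < δ := Real.sqrt_pos.2 (by positivity)
  have hδ2 : k * δ ^ 2 = c / 16 := by
    rw [hδ, Real.sq_sqrt (by positivity)]
    field_simp
  obtain ⟨c₀, hc₀, hb⟩ := hbad δ hδ0
  -- The bound `s ≤ c₀` lets the decay of the bad event beat `exp (L d) = exp (s d ^ 2)`.
  set s := min c₀ (c / (32 * k)) with hs
  have hs0 : 0 < s := lt_min hc₀ (by positivity)
  have hs1 : s ≤ c₀ := min_le_left _ _
  have hs2 : k * s ≤ c / 32 := by
    have := mul_le_mul_of_nonneg_left (min_le_right c₀ (c / (32 * k))) hk0.le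
    refine this.trans (le_of_eq ?_)
    field_simp
  refine ⟨c * s / 2, by positivity, ?_⟩
  filter_upwards [hb, eventually_ge_atTop 2,
    eventually_one_add_mul_sq_le_exp (2 * k * s) (by positivity : 0 < c * s / 8),
    tendsto_natCast_atTop_atTop.eventually_ge_atTop (16 * k / c)] with d h1 h2 h3 h4
  refine (measureReal_powerSumRe_ge_le hk h2 hζ (L := s * d) (by positivity) hδ0.le _).trans ?_
  have h5 : Real.exp (s * d * d) * (haar 𝕜 d).real (largePowerSum 𝕜 k d δ) ≤ 1 := by
    calc _ ≤ Real.exp (s * d * d) * Real.exp (-c₀ * (d : ℝ) ^ 2) := by gcongr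
      _ ≤ 1 := by
        rw [← Real.exp_add, Real.exp_le_one_iff]
        nlinarith [mul_le_mul_of_nonneg_right hs1 (sq_nonneg (d : ℝ))]
  have h6 : 1 + 2 * k * d * (Real.exp (s * d * d) *
      (haar 𝕜 d).real (largePowerSum 𝕜 k d δ)) * (s * d) ≤ Real.exp (c * s / 8 * (d : ℝ) ^ 2) := by
    refine le_trans ?_ h3
    have := mul_le_mul_of_nonneg_left h5 (by positivity : 0 ≤ 2 * k * s * (d : ℝ) ^ 2)
    linarith
  have h7 : 2 * k * (1 + 2 * (s * d) + δ ^ 2 * d) * (s * d) ≤ 3 * (c * s / 8) * (d : ℝ) ^ 2 := by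
    have e : 2 * k * (1 + 2 * (s * d) + δ ^ 2 * d) * (s * d) =
        2 * k * s * d + 4 * (k * s) * (s * (d : ℝ) ^ 2) + 2 * (k * δ ^ 2) * (s * (d : ℝ) ^ 2) := by
      ring
    rw [e, hδ2]
    have h8 : 2 * k * s * d ≤ c * s / 8 * (d : ℝ) ^ 2 := by
      rw [div_le_iff₀ hc] at h4
      have := mul_le_mul_of_nonneg_right h4 (by positivity : 0 ≤ s * (d : ℝ) / 8)
      linarith
    have h9 := mul_le_mul_of_nonneg_right hs2 (by positivity : 0 ≤ s * (d : ℝ) ^ 2)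
    linarith
  calc _ ≤ Real.exp (-(s * d) * (c * d)) * (Real.exp (3 * (c * s / 8) * (d : ℝ) ^ 2) *
        Real.exp (c * s / 8 * (d : ℝ) ^ 2)) := by gcongr
    _ = _ := by
      rw [← Real.exp_add, ← Real.exp_add]
      congr 1
      ring

/-- As `|z| ≤ |Re z| + |Im z|`, one of `± Re z`, `± Im z` is at least `|z| / 2`. Over `ℝ`, where
`RCLike.I = 0`, the last two directions degenerate harmlessly. -/
theorem exists_powerSumRe_ge (k : ℕ) (δ : ℝ) (U : Matrix.unitaryGroup (Fin d) 𝕜)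
    (h : δ * d ≤ ‖powerSum k U‖) :
    ∃ ζ ∈ ({1, -1, RCLike.I, -RCLike.I} : Finset 𝕜), δ / 2 * d ≤ powerSumRe k ζ U := by
  have h1 := RCLike.norm_sq_eq_def (z := powerSum k U)
  set z := powerSum k U with hz
  have h2 : ‖z‖ ≤ |RCLike.re z| + |RCLike.im z| := by
    refine abs_le_of_sq_le_sq' ?_ (by positivity) |>.2
    nlinarith [abs_mul_abs_self (RCLike.re z), abs_mul_abs_self (RCLike.im z),
      abs_nonneg (RCLike.re z), abs_nonneg (RCLike.im z),
      mul_nonneg (abs_nonneg (RCLike.re z)) (abs_nonneg (RCLike.im z))]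
  by_contra! hcon
  have e1 := hcon 1 (by simp)
  have e2 := hcon (-1) (by simp)
  have e3 := hcon RCLike.I (by simp)
  have e4 := hcon (-RCLike.I) (by simp)
  simp only [powerSumRe, ← hz, one_mul, neg_mul, map_neg, RCLike.I_mul_re, neg_neg]
    at e1 e2 e3 e4
  rcases abs_cases (RCLike.re z) with ⟨h3, _⟩ | ⟨h3, _⟩ <;>
  rcases abs_cases (RCLike.im z) with ⟨h4, _⟩ | ⟨h4, _⟩ <;> linarith

/-- The power sums of a random unitary matrix are `o(d)` with overwhelming probability. -/
theorem expSmall_largePowerSum (𝕜 : Type) [RCLike 𝕜] (k : ℕ) {δ : ℝ} (hδ : 0 < δ) :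
    ExpSmall fun d => (haar 𝕜 d).real (largePowerSum 𝕜 k d δ) := by
  -- The threshold must vary: the inductive step needs the lower power sums at a smaller `δ`.
  induction k generalizing δ with
  | zero =>
    refine ⟨1, one_pos, Eventually.of_forall fun d => ?_⟩
    simp [largePowerSum, Real.exp_nonneg]
  | succ k ih =>
    rcases Nat.eq_zero_or_pos k with rfl | hk
    · refine ⟨1, one_pos, Eventually.of_forall fun d => ?_⟩
      simp [largePowerSum, Real.exp_nonneg]
    have hI : ‖(RCLike.I : 𝕜)‖ ≤ 1 := by
      rw [RCLike.norm_I]; split_ifs <;> simp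
    have hζ : ∀ ζ : 𝕜, ‖ζ‖ ≤ 1 → _ := fun ζ h =>
      expSmall_powerSumRe_ge hk (fun δ h => ih h) h (half_pos hδ)
    refine ((((ih hδ).add (hζ 1 (by simp))).add (hζ (-1) (by simp))).add
      ((hζ RCLike.I hI).add (hζ (-RCLike.I) (by simpa using hI)))).mono ?_
    refine Eventually.of_forall fun d => ?_
    have hsub : largePowerSum 𝕜 (k + 1) d δ ⊆
        ((largePowerSum 𝕜 k d δ ∪ {U | δ / 2 * d ≤ powerSumRe k 1 U}) ∪
          {U | δ / 2 * d ≤ powerSumRe k (-1) U}) ∪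
        ({U | δ / 2 * d ≤ powerSumRe k RCLike.I U} ∪
          {U | δ / 2 * d ≤ powerSumRe k (-RCLike.I) U}) := by
      rintro U ⟨a, ha, h⟩
      rw [Finset.mem_Ico] at ha
      rcases (Nat.lt_succ_iff.1 ha.2).lt_or_eq with h1 | rfl
      · exact Or.inl (Or.inl (Or.inl ⟨a, Finset.mem_Ico.2 ⟨ha.1, h1⟩, h⟩))
      · obtain ⟨ζ, hζ, h2⟩ := exists_powerSumRe_ge a δ U h
        simp only [Finset.mem_insert, Finset.mem_singleton] at hζ
        rcases hζ with rfl | rfl | rfl | rfl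
        · exact Or.inl (Or.inl (Or.inr h2))
        · exact Or.inl (Or.inr h2)
        · exact Or.inr (Or.inl h2)
        · exact Or.inr (Or.inr h2)
    refine (measureReal_mono hsub).trans ?_
    refine (measureReal_union_le _ _).trans (add_le_add ?_ (measureReal_union_le _ _))
    refine (measureReal_union_le _ _).trans (add_le_add_left ?_ _)
    exact measureReal_union_le _ _

end Tail

/-! ### Haar measure of operator-norm balls -/

section Ball

variable {𝕜 : Type} [RCLike 𝕜] {d : ℕ}

theorem norm_toEuclideanCLM_of_mem_unitaryGroup {U : Matrix (Fin d) (Fin d) 𝕜}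
    (hU : U ∈ Matrix.unitaryGroup (Fin d) 𝕜) (x : EuclideanSpace 𝕜 (Fin d)) :
    ‖Matrix.toEuclideanCLM (n := Fin d) (𝕜 := 𝕜) U x‖ = ‖x‖ := by
  have h : star (Matrix.toEuclideanCLM (n := Fin d) (𝕜 := 𝕜) U) *
      Matrix.toEuclideanCLM (n := Fin d) (𝕜 := 𝕜) U = 1 := by
    rw [← map_star, ← map_mul, Matrix.mem_unitaryGroup_iff'.1 hU, map_one]
  rw [ContinuousLinearMap.star_eq_adjoint] at h
  exact (ContinuousLinearMap.norm_map_iff_adjoint_comp_self _).2 h x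

theorem opNorm_le_one_of_mem_unitaryGroup {U : Matrix (Fin d) (Fin d) 𝕜}
    (hU : U ∈ Matrix.unitaryGroup (Fin d) 𝕜) : opNorm U ≤ 1 :=
  ContinuousLinearMap.opNorm_le_bound _ zero_le_one fun x => by
    rw [norm_toEuclideanCLM_of_mem_unitaryGroup hU, one_mul]

/-- By the parallelogram law `‖x + U x‖ ^ 2 + ‖x - U x‖ ^ 2 = 4 ‖x‖ ^ 2`. For `ε < 2` this bounds `1
+ U` from below. -/
theorem mul_norm_sq_le_of_opNorm_sub_one_le {U : Matrix (Fin d) (Fin d) 𝕜}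
    (hU : U ∈ Matrix.unitaryGroup (Fin d) 𝕜) {ε : ℝ} (h : opNorm (U - 1) ≤ ε)
    (x : EuclideanSpace 𝕜 (Fin d)) :
    (4 - ε ^ 2) * ‖x‖ ^ 2 ≤ ‖Matrix.toEuclideanCLM (n := Fin d) (𝕜 := 𝕜) (1 + U) x‖ ^ 2 := by
  have h1 := parallelogram_law_with_norm 𝕜 x (Matrix.toEuclideanCLM (n := Fin d) (𝕜 := 𝕜) U x)
  rw [norm_toEuclideanCLM_of_mem_unitaryGroup hU] at h1
  have h2 : ‖x - Matrix.toEuclideanCLM (n := Fin d) (𝕜 := 𝕜) U x‖ ≤ ε * ‖x‖ := by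
    rw [norm_sub_rev]
    have := (Matrix.toEuclideanCLM (n := Fin d) (𝕜 := 𝕜) (U - 1)).le_of_opNorm_le h x
    simpa [map_sub] using this
  have h3 : Matrix.toEuclideanCLM (n := Fin d) (𝕜 := 𝕜) (1 + U) x =
      x + Matrix.toEuclideanCLM (n := Fin d) (𝕜 := 𝕜) U x := by
    simp [map_add]
  rw [h3]
  have h4 := mul_self_le_mul_self (norm_nonneg _) h2
  nlinarith

theorem norm_sq_toEuclideanCLM_single (T : Matrix (Fin d) (Fin d) 𝕜) (i : Fin d) :
    ‖Matrix.toEuclideanCLM (n := Fin d) (𝕜 := 𝕜) T (EuclideanSpace.single i 1)‖ ^ 2 =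
      ∑ j, ‖T j i‖ ^ 2 := by
  rw [EuclideanSpace.norm_sq_eq]
  refine Finset.sum_congr rfl fun j _ => ?_
  rw [Matrix.ofLp_toEuclideanCLM]
  simp

/-- Multiplying the geometric sum by `1 + U` telescopes to `1 - (-U) ^ n`, whose columns have norm
at most `2`. The resulting Frobenius bound is uniform in `n`. -/
theorem sum_norm_sq_geom_sum_le {U : Matrix (Fin d) (Fin d) 𝕜}
    (hU : U ∈ Matrix.unitaryGroup (Fin d) 𝕜) {ε : ℝ} (h : opNorm (U - 1) ≤ ε) (n : ℕ) :
    (4 - ε ^ 2) * ∑ i, ∑ j, ‖(∑ a ∈ Finset.range n, (-U) ^ a) j i‖ ^ 2 ≤ 4 * d := by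
  have hV : (-U) ^ n ∈ Matrix.unitaryGroup (Fin d) 𝕜 := by
    refine pow_mem ?_ n
    rw [Matrix.mem_unitaryGroup_iff] at hU ⊢
    simpa using hU
  have h1 : ∀ i : Fin d, (4 - ε ^ 2) * ∑ j, ‖(∑ a ∈ Finset.range n, (-U) ^ a) j i‖ ^ 2 ≤ 4 := by
    intro i
    rw [← norm_sq_toEuclideanCLM_single]
    refine (mul_norm_sq_le_of_opNorm_sub_one_le hU h _).trans ?_
    rw [← mul_apply_eq_comp, ← map_mul]
    have h2 : (1 + U) * ∑ a ∈ Finset.range n, (-U) ^ a = 1 - (-U) ^ n := by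
      simpa using mul_neg_geom_sum (-U) n
    rw [h2, map_sub, map_one]
    have h3 : ‖(1 - Matrix.toEuclideanCLM (n := Fin d) (𝕜 := 𝕜) ((-U) ^ n))
        (EuclideanSpace.single i 1)‖ ≤ 1 + 1 := by
      rw [sub_apply]
      refine (norm_sub_le _ _).trans (add_le_add ?_ ?_)
      · simp
      · rw [norm_toEuclideanCLM_of_mem_unitaryGroup hV]
        simp
    nlinarith [norm_nonneg ((1 - Matrix.toEuclideanCLM (n := Fin d) (𝕜 := 𝕜) ((-U) ^ n))
        (EuclideanSpace.single i 1))]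
  rw [Finset.mul_sum]
  refine (Finset.sum_le_sum fun i _ => h1 i).trans ?_
  simp [mul_comm]

theorem sum_norm_sq_eq_re_trace (T : Matrix (Fin d) (Fin d) 𝕜) :
    ∑ i, ∑ j, ‖T j i‖ ^ 2 = RCLike.re (star T * T).trace := by
  simp only [Matrix.trace, Matrix.diag, Matrix.mul_apply, Matrix.star_apply, ← starRingEnd_apply,
    RCLike.conj_mul, map_sum]
  norm_cast

theorem trace_star_pow_mul_pow {V : Matrix (Fin d) (Fin d) 𝕜}
    (hV : V ∈ Matrix.unitaryGroup (Fin d) 𝕜) {a b : ℕ} (hab : a ≤ b) :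
    (star (V ^ a) * V ^ b).trace = (V ^ (b - a)).trace := by
  obtain ⟨c, rfl⟩ := Nat.exists_eq_add_of_le hab
  rw [pow_add, ← mul_assoc, Matrix.mem_unitaryGroup_iff'.1 (pow_mem hV a), one_mul,
    Nat.add_sub_cancel_left]

/-- The opposite estimate: when the traces are small, the powers of `V` are nearly orthogonal in the
Frobenius inner product, so the squared norm grows like `n d`. -/
theorem le_sum_norm_sq_geom_sum {V : Matrix (Fin d) (Fin d) 𝕜}
    (hV : V ∈ Matrix.unitaryGroup (Fin d) 𝕜) {n : ℕ} {δ : ℝ} (hδ : 0 ≤ δ)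
    (h : ∀ a ∈ Finset.Ico 1 n, ‖(V ^ a).trace‖ ≤ δ * d) :
    n * d - n ^ 2 * (δ * d) ≤ ∑ i, ∑ j, ‖(∑ a ∈ Finset.range n, V ^ a) j i‖ ^ 2 := by
  have h1 : ∀ a ∈ Finset.range n, ∀ b ∈ Finset.range n,
      (if a = b then (d : ℝ) else 0) - δ * d ≤ RCLike.re (star (V ^ a) * V ^ b).trace := by
    intro a ha b hb
    rw [Finset.mem_range] at ha hb
    split_ifs with hab
    · subst hab
      rw [trace_star_pow_mul_pow hV le_rfl]
      simp only [Nat.sub_self, pow_zero, Matrix.trace_one, Fintype.card_fin, RCLike.natCast_re]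
      have : 0 ≤ δ * d := by positivity
      linarith
    · have h2 : ‖(star (V ^ a) * V ^ b).trace‖ ≤ δ * d := by
        rcases lt_or_gt_of_ne hab with hlt | hlt
        · rw [trace_star_pow_mul_pow hV hlt.le]
          exact h _ (by rw [Finset.mem_Ico]; omega)
        · have e : star (V ^ a) * V ^ b = star (star (V ^ b) * V ^ a) := by simp
          rw [e, Matrix.star_eq_conjTranspose, Matrix.trace_conjTranspose, norm_star,
            trace_star_pow_mul_pow hV hlt.le]
          exact h _ (by rw [Finset.mem_Ico]; omega)
      have := (abs_le.1 ((RCLike.abs_re_le_norm _).trans h2)).1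
      linarith
  rw [sum_norm_sq_eq_re_trace, star_sum, Finset.sum_mul_sum, Matrix.trace_sum, map_sum]
  simp_rw [Matrix.trace_sum, map_sum]
  refine le_trans (le_of_eq ?_)
    (Finset.sum_le_sum fun a ha => Finset.sum_le_sum fun b hb => h1 a ha b hb)
  simp_rw [Finset.sum_sub_distrib, Finset.sum_ite_eq]
  rw [Finset.sum_congr rfl (g := fun _ => (d : ℝ)) (fun a ha => if_pos ha)]
  simp
  ring

/-- A ball of radius less than the diameter has measure `exp (-c d ^ 2)`. -/
theorem expSmall_ball (𝕜 : Type) [RCLike 𝕜] {ε : ℝ} (hε0 : 0 ≤ ε) (hε : ε < 2) :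
    ExpSmall fun d => (haar 𝕜 d).real {U | opNorm ((U : Matrix (Fin d) (Fin d) 𝕜) - 1) ≤ ε} := by
  have he : 0 < 4 - ε ^ 2 := by nlinarith
  -- With `δ = 1 / (2 n)` the lower bound is `n d / 2`, and `(4 - ε ^ 2) n / 2 > 4` contradicts the
  -- upper bound.
  obtain ⟨n, hn⟩ := exists_nat_gt (8 / (4 - ε ^ 2))
  have hn0 : (0 : ℝ) < n := (by positivity : 0 < 8 / (4 - ε ^ 2)).trans hn
  rw [div_lt_iff₀ he] at hn
  refine (expSmall_largePowerSum 𝕜 n (δ := 1 / (2 * n)) (by positivity)).mono ?_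
  filter_upwards [eventually_ge_atTop 1] with d hd
  refine measureReal_mono fun U hU => ?_
  by_contra hcon
  have h1 := sum_norm_sq_geom_sum_le U.2 hU n
  have hV : -(U : Matrix (Fin d) (Fin d) 𝕜) ∈ Matrix.unitaryGroup (Fin d) 𝕜 := by
    rw [Matrix.mem_unitaryGroup_iff]
    simp
  have h2 := le_sum_norm_sq_geom_sum hV (n := n) (δ := 1 / (2 * n)) (by positivity) fun a ha => by
    by_contra! hlt
    refine hcon ⟨a, ha, ?_⟩
    rw [neg_pow] at hlt
    rcases neg_one_pow_eq_or (Matrix (Fin d) (Fin d) 𝕜) a with e | e <;> rw [e] at hlt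
    · simpa [powerSum] using hlt.le
    · simpa [powerSum] using hlt.le
  have h3 := mul_le_mul_of_nonneg_left h2 he.le
  have h4 : (n : ℝ) * d - n ^ 2 * (1 / (2 * n) * d) = n * d / 2 := by
    field_simp
    ring
  rw [h4] at h3
  have hd0 : (1 : ℝ) ≤ d := by exact_mod_cast hd
  nlinarith [mul_lt_mul_of_pos_right hn (by linarith : (0 : ℝ) < d)]

end Ball

/-! ### Nets of two-level matrices and the union bound -/

section Net

variable {𝕜 : Type} [RCLike 𝕜] {d : ℕ}

/-- The two-level unitary matrices over `ℝ` or `ℂ`. -/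
def twoLevel (𝕜 : Type) [RCLike 𝕜] (d : ℕ) : Set (Matrix (Fin d) (Fin d) 𝕜) :=
  {G | G ∈ Matrix.unitaryGroup (Fin d) 𝕜 ∧ ∃ i j : Fin d, i ≠ j ∧
    ∀ k l : Fin d, ¬ ((k = i ∨ k = j) ∧ (l = i ∨ l = j)) →
      G k l = (1 : Matrix (Fin d) (Fin d) 𝕜) k l}

/-- In this form unitarity reduces to `P² = P`, `X² = -P`, `XP = PX = X`, for the plane's projection
`P` and generator `X`. -/
theorem givensMatrix_eq {i j : Fin d} (hij : i ≠ j) (α : ℝ) :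
    givensMatrix 𝕜 i j α = 1 + ((Real.cos α - 1 : ℝ) : 𝕜) •
      (Matrix.single i i 1 + Matrix.single j j 1) + ((Real.sin α : ℝ) : 𝕜) • rotGen 𝕜 i j := by
  ext k l
  simp only [givensMatrix, rotGen, Matrix.of_apply, Matrix.add_apply, Matrix.smul_apply,
    Matrix.sub_apply, Matrix.one_apply, Matrix.single_apply, smul_eq_mul]
  push_cast
  split_ifs <;> grind

theorem givensMatrix_mem_unitaryGroup {i j : Fin d} (hij : i ≠ j) (α : ℝ) :
    givensMatrix 𝕜 i j α ∈ Matrix.unitaryGroup (Fin d) 𝕜 := by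
  have hji := hij.symm
  set P : Matrix (Fin d) (Fin d) 𝕜 := Matrix.single i i 1 + Matrix.single j j 1 with hP
  have hPP : P * P = P := by simp [hP, mul_add, add_mul, hij, hji]
  have hXX : rotGen 𝕜 i j * rotGen 𝕜 i j = -P := by
    simp [hP, rotGen, mul_sub, sub_mul, hij, hji]
    abel
  have hXP : rotGen 𝕜 i j * P = rotGen 𝕜 i j := by
    simp [hP, rotGen, mul_add, sub_mul, hij, hji]
    abel
  have hPX : P * rotGen 𝕜 i j = rotGen 𝕜 i j := by
    simp [hP, rotGen, add_mul, mul_sub, hij, hji]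
  have hPs : star P = P := by simp [hP, Matrix.star_eq_conjTranspose]
  have hXs : star (rotGen 𝕜 i j) = -rotGen 𝕜 i j := by
    simp [rotGen, Matrix.star_eq_conjTranspose]
  have hcs : ((Real.cos α : ℝ) : 𝕜) ^ 2 + ((Real.sin α : ℝ) : 𝕜) ^ 2 = 1 := by
    exact_mod_cast Real.cos_sq_add_sin_sq α
  rw [Matrix.mem_unitaryGroup_iff, givensMatrix_eq hij, ← hP]
  simp only [star_add, star_smul, star_one, hPs, hXs, RCLike.star_def, RCLike.conj_ofReal,
    mul_add, add_mul, smul_mul_smul_comm, hPP, mul_neg, hXX, hXP, hPX, one_mul, mul_one, smul_neg]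
  have e : ∀ c s : 𝕜, ∀ X : Matrix (Fin d) (Fin d) 𝕜, 1 + c • P + s • X + (c • P + (c * c) • P +
      (s * c) • X) + -(s • X + (c * s) • X + -((s * s) • P)) =
      1 + ((c + 1) ^ 2 + s ^ 2 - 1) • P := by
    intro c s X
    module
  refine (e _ _ _).trans ?_
  push_cast
  rw [sub_add_cancel, hcs, sub_self, zero_smul, add_zero]

theorem givensRotations_subset_twoLevel : givensRotations 𝕜 d ⊆ twoLevel 𝕜 d := by
  rintro G ⟨i, j, hij, α, rfl⟩
  refine ⟨givensMatrix_mem_unitaryGroup hij α, i, j, hij, fun k l h => ?_⟩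
  simp only [givensMatrix, Matrix.of_apply, Matrix.one_apply]
  split_ifs <;> grind

theorem opNorm_le_sum_norm (A : Matrix (Fin d) (Fin d) 𝕜) : opNorm A ≤ ∑ i, ∑ j, ‖A i j‖ := by
  refine ContinuousLinearMap.opNorm_le_bound _ (by positivity) fun x => ?_
  have h1 : ∀ y : EuclideanSpace 𝕜 (Fin d), ‖y‖ ≤ ∑ i, ‖y i‖ := fun y => by
    rw [EuclideanSpace.norm_eq]
    exact Real.sqrt_le_iff.2 ⟨by positivity,
      Finset.sum_sq_le_sq_sum_of_nonneg fun i _ => norm_nonneg _⟩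
  refine (h1 _).trans ?_
  rw [Finset.sum_mul]
  refine Finset.sum_le_sum fun i _ => ?_
  rw [Matrix.ofLp_toEuclideanCLM, Finset.sum_mul]
  change ‖∑ j, A i j * x j‖ ≤ _
  refine norm_sum_le_of_le _ fun j _ => ?_
  rw [norm_mul]
  gcongr
  exact PiLp.norm_apply_le (p := 2) x j

/-- Rounding of the real and imaginary parts to multiples of `1 / M`. -/
noncomputable def roundCode (M : ℕ) (z : 𝕜) : Fin (2 * M + 1) × Fin (2 * M + 1) :=
  (Fin.ofNat _ ⌊(RCLike.re z + 1) * M⌋₊, Fin.ofNat _ ⌊(RCLike.im z + 1) * M⌋₊)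

/-- For `|x| ≤ 1` the floor lies in `[0, 2 M]`, so reduction modulo `2 M + 1` loses nothing. -/
theorem abs_sub_le_of_floor_eq {M : ℕ} (hM : 0 < M) {x y : ℝ} (hx : |x| ≤ 1) (hy : |y| ≤ 1)
    (h : Fin.ofNat (2 * M + 1) ⌊(x + 1) * M⌋₊ = Fin.ofNat (2 * M + 1) ⌊(y + 1) * M⌋₊) :
    |x - y| ≤ 1 / M := by
  have hM0 : (0 : ℝ) < M := by exact_mod_cast hM
  have hlt : ∀ x : ℝ, |x| ≤ 1 → ⌊(x + 1) * M⌋₊ < 2 * M + 1 := fun x hx => by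
    rw [Nat.lt_succ_iff]
    refine Nat.floor_le_of_le ?_
    push_cast
    have := (abs_le.1 hx).2
    gcongr
    linarith
  have h' := congrArg Fin.val h
  simp only [Fin.ofNat, Nat.mod_eq_of_lt (hlt x hx), Nat.mod_eq_of_lt (hlt y hy)] at h'
  have hx0 : 0 ≤ (x + 1) * M := mul_nonneg (by linarith [(abs_le.1 hx).1]) hM0.le
  have hy0 : 0 ≤ (y + 1) * M := mul_nonneg (by linarith [(abs_le.1 hy).1]) hM0.le
  have a1 := Nat.floor_le hx0
  have a2 := Nat.lt_floor_add_one ((x + 1) * M)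
  have b1 := Nat.floor_le hy0
  have b2 := Nat.lt_floor_add_one ((y + 1) * M)
  rw [h'] at a1 a2
  rw [abs_le, le_div_iff₀ hM0, neg_le, le_div_iff₀ hM0]
  constructor <;> linarith

theorem norm_sub_le_of_roundCode_eq {M : ℕ} (hM : 0 < M) {z w : 𝕜} (hz : ‖z‖ ≤ 1) (hw : ‖w‖ ≤ 1)
    (h : roundCode M z = roundCode M w) : ‖z - w‖ ≤ 2 / M := by
  have h1 := abs_sub_le_of_floor_eq hM ((RCLike.abs_re_le_norm z).trans hz)
    ((RCLike.abs_re_le_norm w).trans hw) (congrArg Prod.fst h)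
  have h2 := abs_sub_le_of_floor_eq hM ((RCLike.abs_im_le_norm z).trans hz)
    ((RCLike.abs_im_le_norm w).trans hw) (congrArg Prod.snd h)
  have h3 := RCLike.norm_sq_eq_def (z := z - w)
  rw [map_sub, map_sub] at h3
  have h4 : ‖z - w‖ ≤ |RCLike.re z - RCLike.re w| + |RCLike.im z - RCLike.im w| := by
    refine abs_le_of_sq_le_sq' ?_ (by positivity) |>.2
    nlinarith [abs_mul_abs_self (RCLike.re z - RCLike.re w),
      abs_mul_abs_self (RCLike.im z - RCLike.im w),
      mul_nonneg (abs_nonneg (RCLike.re z - RCLike.re w))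
        (abs_nonneg (RCLike.im z - RCLike.im w))]
  calc _ ≤ (1 : ℝ) / M + 1 / M := h4.trans (add_le_add h1 h2)
    _ = 2 / M := by ring

theorem opNorm_sub_le_of_entries {G H : Matrix (Fin d) (Fin d) 𝕜} {i j : Fin d} {c : ℝ}
    (hc : 0 ≤ c)
    (hG : ∀ k l : Fin d, ¬ ((k = i ∨ k = j) ∧ (l = i ∨ l = j)) →
      G k l = (1 : Matrix (Fin d) (Fin d) 𝕜) k l)
    (hH : ∀ k l : Fin d, ¬ ((k = i ∨ k = j) ∧ (l = i ∨ l = j)) →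
      H k l = (1 : Matrix (Fin d) (Fin d) 𝕜) k l)
    (h : ∀ k l : Fin d, (k = i ∨ k = j) → (l = i ∨ l = j) → ‖G k l - H k l‖ ≤ c) :
    opNorm (G - H) ≤ 4 * c := by
  refine (opNorm_le_sum_norm _).trans ?_
  have hcard : (({i, j} : Finset (Fin d)).card : ℝ) ≤ 2 := by
    exact_mod_cast Finset.card_le_two
  have h1 : ∀ k l, k ∉ ({i, j} : Finset (Fin d)) ∨ l ∉ ({i, j} : Finset (Fin d)) →
      ‖(G - H) k l‖ = 0 := by
    intro k l hkl
    simp only [Finset.mem_insert, Finset.mem_singleton] at hkl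
    rw [Matrix.sub_apply, hG k l (by tauto), hH k l (by tauto), sub_self, norm_zero]
  rw [← Finset.sum_subset (Finset.subset_univ {i, j}) fun k _ hk =>
    Finset.sum_eq_zero fun l _ => h1 k l (Or.inl hk)]
  have h2 : ∀ k ∈ ({i, j} : Finset (Fin d)), ∑ l, ‖(G - H) k l‖ ≤ 2 * c := by
    intro k hk
    rw [← Finset.sum_subset (Finset.subset_univ {i, j}) fun l _ hl => h1 k l (Or.inr hl)]
    refine (Finset.sum_le_card_nsmul _ _ c fun l hl => ?_).trans ?_
    · simp only [Finset.mem_insert, Finset.mem_singleton] at hk hl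
      exact h k l hk hl
    · rw [nsmul_eq_mul]
      gcongr
  refine (Finset.sum_le_card_nsmul _ _ _ h2).trans ?_
  rw [nsmul_eq_mul]
  have := mul_le_mul_of_nonneg_right hcard (by positivity : 0 ≤ 2 * c)
  linarith

/-- The codes of two-level unitary matrices: a coordinate plane and four rounded entries. -/
abbrev NetCode (d M : ℕ) : Type :=
  Fin d × Fin d × (Fin 2 × Fin 2 → Fin (2 * M + 1) × Fin (2 * M + 1))

theorem card_netCode (d M : ℕ) :
    Fintype.card (NetCode d M) = d * (d * ((2 * M + 1) * (2 * M + 1)) ^ 4) := by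
  simp

theorem exists_net (𝕜 : Type) [RCLike 𝕜] (d : ℕ) {M : ℕ} (hM : 0 < M) :
    ∃ rep : NetCode d M → Matrix.unitaryGroup (Fin d) 𝕜,
      ∀ G ∈ twoLevel 𝕜 d, ∃ c, opNorm (G - (rep c : Matrix (Fin d) (Fin d) 𝕜)) ≤ 8 / M := by
  classical
  let P : NetCode d M → Matrix (Fin d) (Fin d) 𝕜 → Prop := fun c G =>
    (∀ k l : Fin d, ¬ ((k = c.1 ∨ k = c.2.1) ∧ (l = c.1 ∨ l = c.2.1)) →
      G k l = (1 : Matrix (Fin d) (Fin d) 𝕜) k l) ∧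
    ∀ a b : Fin 2, roundCode M (G (![c.1, c.2.1] a) (![c.1, c.2.1] b)) = c.2.2 (a, b)
  -- A representative is any unitary with the given code, so it is exactly unitary, unlike the
  -- rounded matrix; codes that do not occur get `1`.
  let rep : NetCode d M → Matrix.unitaryGroup (Fin d) 𝕜 := fun c =>
    if h : ∃ G : Matrix.unitaryGroup (Fin d) 𝕜, P c G then h.choose else 1
  refine ⟨rep, ?_⟩
  rintro G ⟨hG, i, j, -, hGij⟩
  let c : NetCode d M := (i, j, fun p => roundCode M (G (![i, j] p.1) (![i, j] p.2)))
  have hGc : P c G := ⟨hGij, fun a b => rfl⟩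
  have hex : ∃ G : Matrix.unitaryGroup (Fin d) 𝕜, P c G := ⟨⟨G, hG⟩, hGc⟩
  have hrep : P c (rep c) := by
    simp only [rep, dif_pos hex]
    exact hex.choose_spec
  refine ⟨c, ?_⟩
  have h8 : (8 : ℝ) / M = 4 * (2 / M) := by ring
  rw [h8]
  refine opNorm_sub_le_of_entries (by positivity) hGc.1 hrep.1 fun k l hk hl => ?_
  have hidx : ∀ k : Fin d, k = i ∨ k = j → ∃ a : Fin 2, ![i, j] a = k := by
    rintro k (rfl | rfl)
    · exact ⟨0, rfl⟩
    · exact ⟨1, rfl⟩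
  obtain ⟨a, rfl⟩ := hidx k hk
  obtain ⟨b, rfl⟩ := hidx l hl
  exact norm_sub_le_of_roundCode_eq hM (entry_norm_bound_of_unitary hG _ _)
    (entry_norm_bound_of_unitary (rep c).2 _ _) ((hGc.2 a b).trans (hrep.2 a b).symm)

theorem opNorm_mul_le (A B : Matrix (Fin d) (Fin d) 𝕜) : opNorm (A * B) ≤ opNorm A * opNorm B := by
  unfold opNorm
  rw [map_mul]
  exact norm_mul_le _ _

theorem opNorm_add_le (A B : Matrix (Fin d) (Fin d) 𝕜) : opNorm (A + B) ≤ opNorm A + opNorm B := by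
  unfold opNorm
  rw [map_add]
  exact norm_add_le _ _

theorem opNorm_nonneg (A : Matrix (Fin d) (Fin d) 𝕜) : 0 ≤ opNorm A := norm_nonneg _

theorem prod_ofFn_mem_unitaryGroup {N : ℕ} {G : Fin N → Matrix (Fin d) (Fin d) 𝕜}
    (hG : ∀ n, G n ∈ Matrix.unitaryGroup (Fin d) 𝕜) :
    (List.ofFn G).prod ∈ Matrix.unitaryGroup (Fin d) 𝕜 :=
  Submonoid.list_prod_mem _ fun x hx => by
    obtain ⟨n, rfl⟩ := List.mem_ofFn.1 hx
    exact hG n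

/-- Factors of norm at most `1` do not amplify errors, so replacing them one at a time makes the
errors add. -/
theorem opNorm_prod_sub_prod_le {N : ℕ} {G H : Fin N → Matrix (Fin d) (Fin d) 𝕜} {c : ℝ}
    (hG : ∀ n, G n ∈ Matrix.unitaryGroup (Fin d) 𝕜)
    (hH : ∀ n, H n ∈ Matrix.unitaryGroup (Fin d) 𝕜)
    (h : ∀ n, opNorm (G n - H n) ≤ c) :
    opNorm ((List.ofFn G).prod - (List.ofFn H).prod) ≤ N * c := by
  induction N with
  | zero => simp [opNorm]
  | succ N ih =>
    have h1 := ih (fun n => hG n.succ) (fun n => hH n.succ) fun n => h n.succ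
    simp only [List.ofFn_succ, List.prod_cons]
    set A := (List.ofFn fun n : Fin N => G n.succ).prod
    set B := (List.ofFn fun n : Fin N => H n.succ).prod
    have hB : B ∈ Matrix.unitaryGroup (Fin d) 𝕜 :=
      prod_ofFn_mem_unitaryGroup fun n => hH n.succ
    have e : G 0 * A - H 0 * B = G 0 * (A - B) + (G 0 - H 0) * B := by noncomm_ring
    rw [e]
    have h2 : opNorm (G 0 * (A - B)) ≤ N * c :=
      (opNorm_mul_le _ _).trans ((mul_le_of_le_one_left (opNorm_nonneg _)
        (opNorm_le_one_of_mem_unitaryGroup (hG 0))).trans h1)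
    have h3 : opNorm ((G 0 - H 0) * B) ≤ c :=
      (opNorm_mul_le _ _).trans ((mul_le_of_le_one_right (opNorm_nonneg _)
        (opNorm_le_one_of_mem_unitaryGroup hB)).trans (h 0))
    push_cast
    linarith [opNorm_add_le (G 0 * (A - B)) ((G 0 - H 0) * B)]

theorem measureReal_ball (P : Matrix.unitaryGroup (Fin d) 𝕜) (ε : ℝ) :
    (haar 𝕜 d).real {U | opNorm ((U : Matrix (Fin d) (Fin d) 𝕜) - (P : Matrix (Fin d) (Fin d) 𝕜)) ≤ ε} ≤
      (haar 𝕜 d).real {U | opNorm ((U : Matrix (Fin d) (Fin d) 𝕜) - 1) ≤ ε} := by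
  have h : {U : Matrix.unitaryGroup (Fin d) 𝕜 | opNorm ((U : Matrix (Fin d) (Fin d) 𝕜) - (P : Matrix (Fin d) (Fin d) 𝕜)) ≤ ε} ⊆
      (fun U => P⁻¹ * U) ⁻¹'
        {U : Matrix.unitaryGroup (Fin d) 𝕜 | opNorm ((U : Matrix (Fin d) (Fin d) 𝕜) - 1) ≤ ε} := by
    intro U hU
    have e : ((P⁻¹ * U : Matrix.unitaryGroup (Fin d) 𝕜) : Matrix (Fin d) (Fin d) 𝕜) - 1 =
        ((P⁻¹ : Matrix.unitaryGroup (Fin d) 𝕜) : Matrix (Fin d) (Fin d) 𝕜) *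
          ((U : Matrix (Fin d) (Fin d) 𝕜) - (P : Matrix (Fin d) (Fin d) 𝕜)) := by
      rw [mul_sub, ← Submonoid.coe_mul, ← Submonoid.coe_mul, inv_mul_cancel]
      rfl
    rw [Set.mem_preimage, Set.mem_ofPred_eq, e]
    exact (opNorm_mul_le _ _).trans ((mul_le_of_le_one_left (opNorm_nonneg _)
      (opNorm_le_one_of_mem_unitaryGroup (P⁻¹).2)).trans hU)
  refine (measureReal_mono h).trans (le_of_eq ?_)
  rw [Measure.real, measure_preimage_mul, Measure.real]

/-- Union bound over the products of net points. -/
theorem measureReal_approxSet_le {S : Set (Matrix (Fin d) (Fin d) 𝕜)} (hS : S ⊆ twoLevel 𝕜 d)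
    (hne : S.Nonempty) {N M : ℕ} (hM : 0 < M) {ε ε' : ℝ} (h : ε + N * (8 / M) < ε') :
    (haar 𝕜 d).real (approxSet S N ε) ≤
      ((d * (d * ((2 * M + 1) * (2 * M + 1)) ^ 4) : ℕ) : ℝ) ^ N *
        (haar 𝕜 d).real {U | opNorm ((U : Matrix (Fin d) (Fin d) 𝕜) - 1) ≤ ε'} := by
  obtain ⟨rep, hrep⟩ := exists_net 𝕜 d hM
  have : Nonempty S := hne.to_subtype
  let Q : (Fin N → NetCode d M) → Matrix.unitaryGroup (Fin d) 𝕜 := fun f =>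
    ⟨(List.ofFn fun n => (rep (f n) : Matrix (Fin d) (Fin d) 𝕜)).prod,
      prod_ofFn_mem_unitaryGroup fun n => (rep (f n)).2⟩
  have hsub : approxSet S N ε ⊆ ⋃ f : Fin N → NetCode d M,
      {U | opNorm ((U : Matrix (Fin d) (Fin d) 𝕜) - (Q f : Matrix (Fin d) (Fin d) 𝕜)) ≤ ε'} := by
    intro U hU
    -- The infimum need not be attained; the strict slack in the radii supplies an actual product.
    obtain ⟨G, hG⟩ := exists_lt_of_ciInf_lt
      (lt_of_le_of_lt hU (by linarith : ε < ε' - N * (8 / M)))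
    choose f hf using fun n => hrep (G n) (hS (G n).2)
    refine Set.mem_iUnion.2 ⟨f, ?_⟩
    have h1 := opNorm_prod_sub_prod_le (fun n => (hS (G n).2).1) (fun n => (rep (f n)).2) hf
    have e : (U : Matrix (Fin d) (Fin d) 𝕜) - (Q f : Matrix (Fin d) (Fin d) 𝕜) =
        ((U : Matrix (Fin d) (Fin d) 𝕜) -
          (List.ofFn fun n => (G n : Matrix (Fin d) (Fin d) 𝕜)).prod) +
        ((List.ofFn fun n => (G n : Matrix (Fin d) (Fin d) 𝕜)).prod - (Q f : Matrix (Fin d) (Fin d) 𝕜)) := by abel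
    rw [Set.mem_ofPred_eq, e]
    have h2 := opNorm_add_le ((U : Matrix (Fin d) (Fin d) 𝕜) -
          (List.ofFn fun n => (G n : Matrix (Fin d) (Fin d) 𝕜)).prod)
        ((List.ofFn fun n => (G n : Matrix (Fin d) (Fin d) 𝕜)).prod - (Q f : Matrix (Fin d) (Fin d) 𝕜))
    linarith
  refine (measureReal_mono hsub).trans ((measureReal_iUnion_fintype_le _).trans ?_)
  refine (Finset.sum_le_card_nsmul _ _ _ fun f _ => measureReal_ball (Q f) ε').trans (le_of_eq ?_)
  rw [nsmul_eq_mul, Finset.card_univ, Fintype.card_fun, card_netCode, Fintype.card_fin]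
  push_cast
  rfl

end Net

/-! ### Comparing the net size with the ball measure -/

theorem ExpSmall.tendsto_zero {u : ℕ → ℝ} (hu : ExpSmall u) (h0 : ∀ d, 0 ≤ u d) :
    Tendsto u atTop (𝓝 0) := by
  obtain ⟨c, hc, hu⟩ := hu
  have h1 : Tendsto (fun d : ℕ => (d : ℝ) ^ 2) atTop atTop :=
    (tendsto_pow_atTop two_ne_zero).comp tendsto_natCast_atTop_atTop
  have h2 : Tendsto (fun d : ℕ => Real.exp (-c * (d : ℝ) ^ 2)) atTop (𝓝 0) :=
    Real.tendsto_exp_atBot.comp (h1.const_mul_atTop_of_neg (neg_neg_of_pos hc))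
  exact squeeze_zero' (Eventually.of_forall h0) hu h2

theorem eventually_mul_log_le {N : ℕ → ℕ}
    (hN : (fun d : ℕ => (N d : ℝ)) =o[atTop] fun d : ℕ => (d : ℝ) ^ 2 / Real.log d)
    {κ : ℝ} (hκ : 0 < κ) : ∀ᶠ d : ℕ in atTop, N d * Real.log d ≤ κ * (d : ℝ) ^ 2 := by
  filter_upwards [hN.def hκ, eventually_ge_atTop 2] with d h1 h2
  have hl : 0 < Real.log d := Real.log_pos (by exact_mod_cast h2)
  rw [Real.norm_of_nonneg (by positivity), Real.norm_of_nonneg (by positivity)] at h1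
  have := mul_le_mul_of_nonneg_right h1 hl.le
  rwa [mul_assoc, div_mul_cancel₀ _ hl.ne'] at this

theorem tendsto_haar_approxSet {𝕜 : Type} [RCLike 𝕜] {ε : ℝ} (hε : 0 < ε) (hε2 : ε < 2)
    {N : ℕ → ℕ}
    (hN : (fun d : ℕ => (N d : ℝ)) =o[atTop] fun d : ℕ => (d : ℝ) ^ 2 / Real.log d)
    {S : ∀ d, Set (Matrix (Fin d) (Fin d) 𝕜)} (hS : ∀ d, S d ⊆ twoLevel 𝕜 d)
    (hne : ∀ d, 2 ≤ d → (S d).Nonempty) :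
    Tendsto (fun d : ℕ => haar 𝕜 d (approxSet (S d) (N d) ε)) atTop (𝓝 0) := by
  -- Half of the gap to `2`: the enlarged radius `ε + η` is still below `2`.
  set η := (2 - ε) / 2 with hη
  have hη0 : 0 < η := by rw [hη]; linarith
  obtain ⟨c, hc, hball⟩ := expSmall_ball 𝕜 (ε := ε + η) (by linarith) (by rw [hη]; linarith)
  obtain ⟨C, hC⟩ := exists_nat_gt (8 / η)
  have hC0 : (0 : ℝ) < C := (by positivity : 0 < 8 / η).trans hC
  have hC1 : 1 ≤ C := by exact_mod_cast hC0
  have hsmall : ExpSmall fun d => (haar 𝕜 d).real (approxSet (S d) (N d) ε) := by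
    refine ⟨c / 2, by positivity, ?_⟩
    -- The net has at most `d ^ (26 N)` points, so `c / 52` makes the union bound cost `exp (c d ^ 2
    -- / 2)`, half of the available decay.
    filter_upwards [hball, eventually_mul_log_le hN (by positivity : 0 < c / 52),
      eventually_mul_log_le hN one_pos, eventually_ge_atTop (max 3 (5 * C))]
      with d h1 h2 h3 h4
    have hd3 : 3 ≤ d := (le_max_left _ _).trans h4
    have hdC : 5 * C ≤ d := (le_max_right _ _).trans h4
    have hd0 : (0 : ℝ) < d := by exact_mod_cast (by omega : 0 < d)
    have hlog : 1 ≤ Real.log d := by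
      rw [Real.le_log_iff_exp_le hd0]
      exact Real.exp_one_lt_three.le.trans (by exact_mod_cast hd3)
    have hNd : N d ≤ d ^ 2 := by
      have : (N d : ℝ) ≤ (d : ℝ) ^ 2 := by
        rw [one_mul] at h3
        exact (le_mul_of_one_le_right (Nat.cast_nonneg _) hlog).trans h3
      exact_mod_cast this
    -- The accumulated rounding error `8 N / M` is at most `8 / C < η`; the `+ 1` keeps `M` positive
    -- when `N d = 0`.
    set M := C * (N d + 1) with hM
    have hM0 : 0 < M := by positivity
    have hMd : 2 * M + 1 ≤ d ^ 3 := by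
      have h5 : M ≤ C * (d ^ 2 + 1) := Nat.mul_le_mul_left _ (by omega)
      have h6 : 5 * C * d ^ 2 ≤ d ^ 3 := by
        rw [pow_succ' d 2]
        exact Nat.mul_le_mul_right _ hdC
      nlinarith
    have hcount : d * (d * ((2 * M + 1) * (2 * M + 1)) ^ 4) ≤ d ^ 26 :=
      calc d * (d * ((2 * M + 1) * (2 * M + 1)) ^ 4) ≤ d * (d * (d ^ 3 * d ^ 3) ^ 4) := by gcongr
        _ = d ^ 26 := by ring
    have hstep : ε + N d * (8 / M) < ε + η := by
      have h5 : (N d : ℝ) * (8 / M) ≤ 8 / C := by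
        rw [hM]
        push_cast
        rw [mul_div_assoc', div_le_div_iff₀ (by positivity) hC0]
        nlinarith
      have h6 : 8 / (C : ℝ) < η := by
        rw [div_lt_iff₀ hη0] at hC
        rw [div_lt_iff₀ hC0]
        linarith
      linarith
    refine (measureReal_approxSet_le (hS d) (hne d (by omega)) hM0 hstep).trans ?_
    calc _ ≤ ((d : ℝ) ^ 26) ^ N d * Real.exp (-c * (d : ℝ) ^ 2) := by
          gcongr
          exact_mod_cast hcount
      _ = Real.exp (26 * (N d * Real.log d) + -c * (d : ℝ) ^ 2) := by
          rw [Real.exp_add, ← pow_mul, ← Real.exp_log (pow_pos hd0 (26 * N d)), Real.log_pow]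
          push_cast
          ring_nf
      _ ≤ Real.exp (-(c / 2) * (d : ℝ) ^ 2) := by
          gcongr
          linarith
  have h := hsmall.tendsto_zero fun d => measureReal_nonneg
  have h' := ENNReal.tendsto_ofReal h
  simpa [ofReal_measureReal] using h'

theorem givensRotations_nonempty (𝕜 : Type) [RCLike 𝕜] {d : ℕ} (hd : 2 ≤ d) :
    (givensRotations 𝕜 d).Nonempty :=
  ⟨_, ⟨0, by omega⟩, ⟨1, by omega⟩, by simp, 0, rfl⟩

end GivensApprox

theorem theorem1 (ε : ℝ) (hε : 0 < ε) (hε2 : ε < 2) (N : ℕ → ℕ)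
    (hN : (fun d : ℕ => (N d : ℝ)) =o[atTop] fun d : ℕ => (d : ℝ) ^ 2 / Real.log d) :
    Tendsto (fun d : ℕ => haar ℂ d (approxSet (givensRotations ℂ d) (N d) ε)) atTop (𝓝 0) ∧
    Tendsto (fun d : ℕ => haar ℂ d (approxSet (twoLevelUnitaries d) (N d) ε)) atTop (𝓝 0) ∧
    Tendsto (fun d : ℕ => haar ℝ d (approxSet (givensRotations ℝ d) (N d) ε)) atTop (𝓝 0) :=
  ⟨tendsto_haar_approxSet hε hε2 hN (fun _ => givensRotations_subset_twoLevel)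
      fun _ => givensRotations_nonempty ℂ,
    -- Over `ℂ`, `twoLevel` unfolds to `twoLevelUnitaries`.
    tendsto_haar_approxSet hε hε2 hN (fun _ => subset_rfl) fun _ hd =>
      (givensRotations_nonempty ℂ hd).mono givensRotations_subset_twoLevel,
    tendsto_haar_approxSet hε hε2 hN (fun _ => givensRotations_subset_twoLevel)
      fun _ => givensRotations_nonempty ℝ⟩
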